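/- **Types and the Markov process.** A type is a word of length two in the letters $n,s$. Types are multiplied letter by letter, where $ss=nn=s$ and $sn=ns=n$ for single letters, and $f(t_1t_2)=t_2t_1$. A factor $[T,d]$ consists of a type $T$ and a degree $d\ge 1$; a factorization type is a finite formal product (multiset) of factors. A factor has the following children. If $T$ starts with $n$, then $[T,d]\to[f(T),2d]$. If $T$ starts with $s$, then $[T,d]\to[T_1,d][T_2,d]$, where all pairs of types $(T_1,T_2)$ with $T_1T_2=f(T)$ whose second letters agree are equally probable. Explicitly, $[nn,d]\to[nn,2d]$; $[ns,d]\to[sn,2d]$; $[sn,d]\to[ns,d][ss,d]$ or $[nn,d][sn,d]$, each with probability $\frac12$; $[ss,d]\to[T',d][T',d]$ for $T'\in\{nn,ns,sn,ss\}$, each with probability $\frac14$. Different factors have their children independently. **Model 5.** (This model comes from factoring the polynomials $h_a(x)=(x+a)^2-a-1$, $a\in\mathbb Z$, $a\neq\pm b^2$, modulo primes $\equiv1\pmod 4$; their critical point $-a$ is periodic with post-critical orbit $\{-a-1,-a\}$.) The level $1$ data is the probability distribution $$([nn,2],\tfrac14),\ ([sn,2],\tfrac14),\ ([nn,1][sn,1],\tfrac18),\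 ([ns,1][ss,1],\tfrac18),$$ $$([nn,1][nn,1],\tfrac1{16}),\ ([ns,1][ns,1],\tfrac1{16}),\ ([sn,1][sn,1],\tfrac1{16}),\ ([ss,1][ss,1],\tfrac1{16}),$$ and the level $n$ data is the distribution obtained from it by applying the Markov process $n-1$ times. The level $n$ cycle data is the induced distribution on multisets of degrees (the types are forgotten). **The groups.** Let $T_n$ be the complete binary rooted tree of height $n$, its leaves numbered $1,\dots,2^n$ from left to right, and $W_n=\mathrm{Aut}(T_n)$, acting on the leaves; for $i<n$, $W_i$ is viewed as the subgroup of $W_n$ acting on the first $2^i$ leaves and fixing the others. Products of permutations are composed from right to left. Put $a_j=(1,2^{j-1}+1)(2,2^{j-1}+2)\cdots(2^{j-1},2^j)$, $x_k=a_1a_2\cdots a_k$ and $v_i=x_{i+2}^2$. Let $m_1=\mathrm{id}$ and $m_2=(1,2)\in W_2$, with the type $sn$ attached to its cycle $(1,2)$ and the type $ss$ to each of its fixed points. For $n\ge2$ the permutation $m_{n+1}$, with types attached to its cycles, is obtained from $m_n$ by the Markov map: a cycle $(c_1,\dots,c_k)$ of $m_n$, written with its smallest element first, of a type $T$ is replaced,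 if $T$ starts with $n$, by the cycle $(2c_1-1,\dots,2c_k-1,2c_1,\dots,2c_k)$ with the type $f(T)$, and, if $T$ starts with $s$, by the two cycles $(2c_1-1,\dots,2c_k-1)$ and $(2c_1,\dots,2c_k)$ with the types $nn$ and $sn$ if $T=sn$, and both with the type $ss$ if $T=ss$. For $n\ge1$ let $$M_n=\langle x_n,\ m_n,\ v_{n-3},\dots,v_0\rangle$$ (no $v_i$ if $n\le2$). **Theorem C.** For every $n\ge1$, $M_n$ is a subgroup of $W_n$ that satisfies Model 5: for every multiset $c$ of positive integers, the proportion of the elements of $M_n$ whose cycle type (with cycles of length $1$ included) is $c$ equals the probability of $c$ in the level $n$ cycle data of Model 5. -/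

import Mathlib

namespace PCFMarkov

/-! ### Types and the Markov process -/

/-- A digit of a type: `s` (the value is a square) or `n` (it is not a square). -/
inductive Digit where
  | n : Digit
  | s : Digit
deriving DecidableEq

instance : Fintype Digit where
  elems := {Digit.n, Digit.s}
  complete := fun d => by cases d <;> decide

/-- Digits multiply like values of the quadratic character: `s` is the identity, `n * n = s`. -/
instance : Mul Digit where
  mul
    | .s, e => e
    | d, .s => d
    | .n, .n => .s

/-- A type for a quadratic polynomial whose post-critical orbit is `{f(c), f²(c)}`. -/
abbrev Typ : Type := Digit × Digit

/-- The type `nn`. -/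
def nn : Typ := (Digit.n, Digit.n)
/-- The type `ns`. -/
def ns : Typ := (Digit.n, Digit.s)
/-- The type `sn`. -/
def sn : Typ := (Digit.s, Digit.n)
/-- The type `ss`. -/
def ss : Typ := (Digit.s, Digit.s)

/-- The action of `f` on types when `f³(c) = f(c)`: shift one position to the left and use the
first entry as the new last entry. -/
def Typ.shift (T : Typ) : Typ := (T.2, T.1)

/-- The allowable (ordered) pairs of types `(T₁, T₂)` of the two children of a factor whose type
`T` starts with `s`: the product of the two types is `f(T)`, and, the critical point being
periodic, their last digits agree. -/
def allowable (T : Typ) : Finset (Typ × Typ) :=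
  Finset.univ.filter fun q => q.1 * q.2 = T.shift ∧ q.1.2 = q.2.2

/-- A factorization type `∏ [tᵢ, dᵢ]`: the multiset of the pairs (type, degree). -/
abbrev FactType : Type := Multiset (Typ × ℕ)

/-- A level data: a finite formal sum of factorization types, the coefficient of a factorization
type being its density.  Equal factorization types are merged by adding up their densities; the
product of two such sums joins independent factorization types and multiplies the densities. -/
abbrev Data : Type := AddMonoidAlgebra ℚ FactType

/-- The datum `(F, r)`. -/
noncomputable def datum (F : FactType) (r : ℚ) : Data := AddMonoidAlgebra.single F r

/-- One transition of the process for a single factor `[T, d]`.  If `T` starts with `n`, there is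
one child `[f(T), 2d]`.  If `T` starts with `s`, there are two children `[T₁, d][T₂, d]`, all
allowable pairs `(T₁, T₂)` being equally probable. -/
noncomputable def children (p : Typ × ℕ) : Data :=
  match p.1.1 with
  | .n => datum {(p.1.shift, 2 * p.2)} 1
  | .s => ∑ q ∈ allowable p.1, datum {(q.1, p.2), (q.2, p.2)} (1 / ((allowable p.1).card : ℚ))

/-- The process applied to a level `n` data: the factors of each factorization type have their
children independently of each other. -/
noncomputable def step (D : Data) : Data :=
  D.coeff.sum fun F r => r • (F.map children).prod

/-- The level `n` data (`1 ≤ n`) obtained from the level `1` data `D`. -/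
noncomputable def levelData (D : Data) (n : ℕ) : Data := step^[n - 1] D

/-- The level `n` cycle data obtained from the level `1` data `D`: forget the types and keep the
degrees, adding up the densities that belong to the same multiset of degrees. -/
noncomputable def modelCycleData (D : Data) (n : ℕ) : Multiset ℕ →₀ ℚ :=
  (levelData D n).coeff.mapDomain (Multiset.map Prod.snd)

/-- The level `1` data of Model 5 (the even Markov model of `(x + a)² - a - 1`, `a ≠ ± b²`; its
post-critical orbit is `{-a-1, -a}`, the critical point `-a` being periodic). -/
noncomputable def model5 : Data :=
  datum {(nn, 2)} (1 / 4) + datum {(sn, 2)} (1 / 4) +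
  datum {(nn, 1), (sn, 1)} (1 / 8) + datum {(ns, 1), (ss, 1)} (1 / 8) +
  datum {(nn, 1), (nn, 1)} (1 / 16) + datum {(ns, 1), (ns, 1)} (1 / 16) +
  datum {(sn, 1), (sn, 1)} (1 / 16) + datum {(ss, 1), (ss, 1)} (1 / 16)

/-! ### The tree of height `n`

The leaves of the complete binary rooted tree `Tₙ` are numbered from left to right by
`0, …, 2ⁿ - 1`.  The leaves `i` and `j` lie below the same vertex at distance `k` from the leaves
if and only if `i / 2ᵏ = j / 2ᵏ`.  -/

/-- `Aut(Tₙ)` as a group of permutations of the leaves. -/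
def treeAut (n : ℕ) : Subgroup (Equiv.Perm (Fin (2 ^ n))) where
  carrier := {g | ∀ (k : ℕ) (i j : Fin (2 ^ n)),
    (g i).val / 2 ^ k = (g j).val / 2 ^ k ↔ i.val / 2 ^ k = j.val / 2 ^ k}
  mul_mem' := fun ha hb k i j => (ha k _ _).trans (hb k i j)
  one_mem' := fun _ _ _ => Iff.rfl
  inv_mem' := fun {g} hg k i j => by
    have h := hg k (g⁻¹ i) (g⁻¹ j)
    rw [← Equiv.Perm.mul_apply, ← Equiv.Perm.mul_apply, mul_inv_cancel] at h
    exact h.symm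

/-- The cycle data of `G`: the proportion of the elements of `G` with cycle type `c`, where
cycles of length `1` are counted. -/
noncomputable def cycleProportion {n : ℕ} (G : Subgroup (Equiv.Perm (Fin (2 ^ n))))
    (c : Multiset ℕ) : ℚ :=
  (Nat.card {g : G // (g : Equiv.Perm (Fin (2 ^ n))).partition.parts = c} : ℚ) / Nat.card G

/-- `G` is a group of automorphisms of `Tₙ` whose cycle data match the level `n` cycle data
obtained from the level `1` data `D`. -/
def Satisfies (D : Data) (n : ℕ) (G : Subgroup (Equiv.Perm (Fin (2 ^ n)))) : Prop :=
  G ≤ treeAut n ∧ ∀ c : Multiset ℕ, cycleProportion G c = modelCycleData D n c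

/-! ### The standard generators and odometers -/

/-- The map that exchanges `i` and `i + 2 ^ (j - 1)` for `0 ≤ i < 2 ^ (j - 1)` and fixes all
other numbers. -/
def swapHalves (j i : ℕ) : ℕ :=
  if i < 2 ^ (j - 1) then i + 2 ^ (j - 1)
  else if i < 2 ^ (j - 1) + 2 ^ (j - 1) then i - 2 ^ (j - 1)
  else i

theorem swapHalves_swapHalves (j i : ℕ) : swapHalves j (swapHalves j i) = i := by
  unfold swapHalves
  split_ifs <;> omega

theorem swapHalves_lt {n j i : ℕ} (hj : 1 ≤ j ∧ j ≤ n) (hi : i < 2 ^ n) :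
    swapHalves j i < 2 ^ n := by
  have h : 2 ^ (j - 1) + 2 ^ (j - 1) ≤ 2 ^ n := by
    rw [← two_mul, ← pow_succ', Nat.sub_add_cancel hj.1]
    exact Nat.pow_le_pow_right (by norm_num) hj.2
  unfold swapHalves
  split_ifs <;> omega

/-- The generator `a_j = (1, 2^{j-1}+1)(2, 2^{j-1}+2) ⋯ (2^{j-1}, 2^j)` (leaves numbered
from `1`), as an element of `Wₙ`, for `1 ≤ j ≤ n`.  (Not used for other `j`.) -/
def a (n j : ℕ) : Equiv.Perm (Fin (2 ^ n)) :=
  if hj : 1 ≤ j ∧ j ≤ n then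
    { toFun := fun i => ⟨swapHalves j i, swapHalves_lt hj i.isLt⟩
      invFun := fun i => ⟨swapHalves j i, swapHalves_lt hj i.isLt⟩
      left_inv := fun i => Fin.ext (swapHalves_swapHalves j i)
      right_inv := fun i => Fin.ext (swapHalves_swapHalves j i) }
  else 1

/-- `x_k = a_1 a_2 ⋯ a_k`, the standard `k`-odometer, as an element of `Wₙ` for `k ≤ n`.
Products are composed from right to left. -/
def x (n : ℕ) : ℕ → Equiv.Perm (Fin (2 ^ n))
  | 0 => 1
  | k + 1 => x n k * a n (k + 1)

/-- `v_i = x_{i+2}²`, as an element of `Wₙ` for `i + 2 ≤ n`. -/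
def v (n i : ℕ) : Equiv.Perm (Fin (2 ^ n)) := x n (i + 2) ^ 2

/-! ### The Markov map -/

/-- An element of `Wₙ` together with a formal type attached to each of its cycles. -/
structure TypedPerm (n : ℕ) where
  /-- the permutation of the leaves -/
  perm : Equiv.Perm (Fin (2 ^ n))
  /-- the type of the cycle through a given leaf -/
  type : Fin (2 ^ n) → Typ
  /-- the type depends only on the cycle -/
  type_perm : ∀ i, type (perm i) = type i

/-- The leaf `i` of `Tₙ` has the children `2i` and `2i + 1` in `Tₙ₊₁`. -/
def childEquiv (n : ℕ) : Fin (2 ^ n) × Fin 2 ≃ Fin (2 ^ (n + 1)) :=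
  finProdFinEquiv.trans (finCongr (pow_succ 2 n).symm)

/-- The formal types of the children in the restricted process: `nn → nn`, `ns → sn`,
`sn → nn, sn` and `ss → ss, ss`.  For a type that starts with `s` the value at `b` is the type of
the `b`-th child; for a type that starts with `n` there is only one child, and the value does not
depend on `b`. -/
def restrictedChild : Typ → Fin 2 → Typ
  | (.n, .n), _ => nn
  | (.n, .s), _ => sn
  | (.s, .n), b => if b = 0 then nn else sn
  | (.s, .s), _ => ss

/-- A leaf at which a sheet change happens: `j` is the smallest element of its cycle, and the type
of this cycle starts with `n`. -/
def TypedPerm.Crossing {n : ℕ} (X : TypedPerm n) (j : Fin (2 ^ n)) : Prop :=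
  (X.type j).1 = Digit.n ∧ ∀ k, X.perm.SameCycle j k → j ≤ k

open Classical in
/-- Doublings and splittings.  Let `(c₁, …, cₖ)` be a cycle, written with its smallest element
first.  If its type starts with `n`, it is replaced by the standard doubling
`(2c₁-1, …, 2cₖ-1, 2c₁, …, 2cₖ)`; if its type starts with `s`, by the standard splitting
`(2c₁-1, …, 2cₖ-1)(2c₁, …, 2cₖ)`  (leaves numbered from `1`). -/
noncomputable def TypedPerm.liftPerm {n : ℕ} (X : TypedPerm n) :
    Equiv.Perm (Fin (2 ^ (n + 1))) :=
  (childEquiv n).permCongr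
    (Equiv.prodShear X.perm fun i => if X.Crossing (X.perm i) then Equiv.swap 0 1 else 1)

/-- The types attached to the cycles of the doublings and splittings. -/
def TypedPerm.liftType {n : ℕ} (X : TypedPerm n) (l : Fin (2 ^ (n + 1))) : Typ :=
  restrictedChild (X.type ((childEquiv n).symm l).1) ((childEquiv n).symm l).2

theorem restrictedChild_const {T : Typ} (h : T.1 = Digit.n) (b b' : Fin 2) :
    restrictedChild T b = restrictedChild T b' := by
  obtain ⟨d, e⟩ := T
  subst h
  cases e <;> rfl

/-- The Markov map of level `n`. -/
noncomputable def markovMap {n : ℕ} (X : TypedPerm n) : TypedPerm (n + 1) where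
  perm := X.liftPerm
  type := X.liftType
  type_perm := fun l => by
    obtain ⟨⟨i, b⟩, rfl⟩ := (childEquiv n).surjective l
    simp only [TypedPerm.liftType, TypedPerm.liftPerm, Equiv.permCongr_apply,
      Equiv.symm_apply_apply, Equiv.prodShear_apply, X.type_perm]
    split_ifs with h
    · exact restrictedChild_const ((X.type_perm i) ▸ h.1) _ _
    · rfl

/-! ### The groups `Mₙ` -/

theorem a_two_one (i : Fin (2 ^ 2)) : ((a 2 1 i).val < 2) ↔ i.val < 2 := by
  revert i
  decide

/-- `(1, 2) ∈ W₂` with the type `[sn,2][ss,1]²`. -/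
def mTypedTwo : TypedPerm 2 where
  perm := a 2 1
  type := fun i => if i.val < 2 then sn else ss
  type_perm := fun i => by simp only [a_two_one]

/-- The result of applying the Markov map `k` times to `(1, 2) ∈ W₂`. -/
noncomputable def mTyped : (k : ℕ) → TypedPerm (k + 2)
  | 0 => mTypedTwo
  | k + 1 => markovMap (mTyped k)

/-- `m₁ = id`, and `mₙ` for `2 ≤ n` is obtained from `m₂ = (1, 2)` by successive application of
the Markov map.  (The value at `0` is not used.) -/
noncomputable def m : (n : ℕ) → Equiv.Perm (Fin (2 ^ n))
  | 0 => 1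
  | 1 => 1
  | k + 2 => (mTyped k).perm

/-- `Mₙ = ⟨xₙ, mₙ, v_{n-3}, …, v_0⟩`. -/
noncomputable def M (n : ℕ) : Subgroup (Equiv.Perm (Fin (2 ^ n))) :=
  Subgroup.closure ({x n n, m n} ∪ {g | ∃ i, i + 3 ≤ n ∧ g = v n i})

end PCFMarkov

namespace PCFMarkov

/-! ### The tower of wreath-like extensions -/

/-! The idea is to replace `M n` by a larger group `Tow n` in which types are visible. Start with
the Klein four-group of types. Given a group with a type homomorphism, form all pairs (g, h) of its
elements and let such a pair act on two copies of the tree, exchanging them exactly when the second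
digit of typ(g) typ(h) is n. Since types commute, this digit is multiplicative, so the pairs form a
group, and the shift of typ(g) typ(h) is again a type homomorphism.

The Markov process is the conjugacy bookkeeping of this extension. If (g, h) exchanges the halves,
its cycles are those of gh with doubled lengths; for fixed h the product gh is uniformly
distributed, and its type is the shifted type. This is the transition [T,d] → [f(T),2d]. If the
halves are preserved, the cycles are those of g and h together, and the admissible pairs of types
are the allowable ones, each equally likely. Hence elements of type T have the cycle data of the
process started at [T,1] (`cycleSum_eq`), and the uniform distribution on the four types gives Model
5 after one step (`stepHom_level_zero`).

It remains to see that the image of `Tow n` on the leaves is `M n` (`range_act`), since a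
homomorphism of finite groups preserves proportions. The tower is generated by an odometer of type
nn, the squares of smaller odometers, and one element of type ns or sn (`closure_tow_eq_top`). Any
element of type ns or sn will do, by a Frattini-type argument for 2-groups, so it suffices to find
such an element above `m n`. It is obtained by labelling the smallest leaf of each cycle by the type
of the cycle and all other leaves by ss: the Markov map then refines the labels one level at a time
without changing the type at the root (`TypedPerm.coarsen_labels`). -/

instance : CommGroup Digit where
  mul := (· * ·)
  one := .s
  inv := id
  mul_assoc := by decide
  one_mul := by decide
  mul_one := by decide
  inv_mul_cancel := by decide
  mul_comm := by decide

/-- `Typ.shift` as a homomorphism. -/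
def shiftHom : Typ →* Typ where
  toFun := Typ.shift
  map_one' := by decide
  map_mul' := by decide

/-- The pairs of elements of a group with a type homomorphism; such a pair stands for the pair of
sections of a tree automorphism, which exchanges the two halves of the tree
according to the second digit of the product of the types of the sections. -/
@[ext]
structure Ext {A : Type} [Group A] (τ : A →* Typ) where
  /-- the section that maps into the first half -/
  fst : A
  /-- the section that maps into the second half -/
  snd : A

namespace Ext

variable {A : Type} [Group A] {τ : A →* Typ}

/-- The digit that tells whether the halves are exchanged. -/
def swap (g : Ext τ) : Digit := (τ g.fst * τ g.snd).2

instance : Mul (Ext τ) where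
  mul g h := if g.swap = .n then ⟨g.fst * h.snd, g.snd * h.fst⟩ else ⟨g.fst * h.fst, g.snd * h.snd⟩

instance : One (Ext τ) := ⟨⟨1, 1⟩⟩

instance : Inv (Ext τ) where
  inv g := if g.swap = .n then ⟨g.snd⁻¹, g.fst⁻¹⟩ else ⟨g.fst⁻¹, g.snd⁻¹⟩

theorem mul_def (g h : Ext τ) : g * h =
    if g.swap = .n then ⟨g.fst * h.snd, g.snd * h.fst⟩ else ⟨g.fst * h.fst, g.snd * h.snd⟩ := rfl

theorem one_def : (1 : Ext τ) = ⟨1, 1⟩ := rfl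

theorem inv_def (g : Ext τ) : g⁻¹ =
    if g.swap = .n then ⟨g.snd⁻¹, g.fst⁻¹⟩ else ⟨g.fst⁻¹, g.snd⁻¹⟩ := rfl

theorem mul_of_swap {g : Ext τ} (hg : g.swap = .n) (h : Ext τ) :
    g * h = ⟨g.fst * h.snd, g.snd * h.fst⟩ := by rw [mul_def, if_pos hg]

theorem mul_of_not_swap {g : Ext τ} (hg : g.swap = .s) (h : Ext τ) :
    g * h = ⟨g.fst * h.fst, g.snd * h.snd⟩ := by rw [mul_def, if_neg (by simp [hg])]

/-- An exchange only permutes the two sections of the second factor, which is invisible in the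
commutative group of types. This makes both the exchange digit and the type multiplicative. -/
theorem typ_prod_mul (g h : Ext τ) :
    τ (g * h).fst * τ (g * h).snd = (τ g.fst * τ g.snd) * (τ h.fst * τ h.snd) := by
  rw [mul_def]
  split_ifs <;> simp only [map_mul]
  · rw [mul_mul_mul_comm, mul_comm (τ h.snd)]
  · rw [mul_mul_mul_comm]

theorem swap_mul (g h : Ext τ) : (g * h).swap = g.swap * h.swap := by
  simp only [swap, typ_prod_mul g h, Prod.snd_mul]

theorem swap_one : (1 : Ext τ).swap = .s := by
  simp only [swap, one_def, map_one]; rfl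

instance : Group (Ext τ) where
  mul_assoc f g h := by
    rcases hf : f.swap <;> rcases hg : g.swap
    · have : (f * g).swap = .s := by rw [swap_mul, hf, hg]; rfl
      rw [mul_of_not_swap this]; simp only [mul_of_swap hf, mul_of_swap hg, mul_assoc]
    · have : (f * g).swap = .n := by rw [swap_mul, hf, hg]; rfl
      rw [mul_of_swap this]; simp only [mul_of_swap hf, mul_of_not_swap hg, mul_assoc]
    · have : (f * g).swap = .n := by rw [swap_mul, hf, hg]; rfl
      rw [mul_of_swap this]; simp only [mul_of_not_swap hf, mul_of_swap hg, mul_assoc]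
    · have : (f * g).swap = .s := by rw [swap_mul, hf, hg]; rfl
      rw [mul_of_not_swap this]; simp only [mul_of_not_swap hf, mul_of_not_swap hg, mul_assoc]
  one_mul g := by
    rw [mul_of_not_swap swap_one]; simp [one_def]
  mul_one g := by
    rw [mul_def]; split_ifs <;> simp [one_def]
  inv_mul_cancel g := by
    rcases hg : g.swap
    · have h1 : g⁻¹ = ⟨g.snd⁻¹, g.fst⁻¹⟩ := by rw [inv_def, if_pos hg]
      have : g⁻¹.swap = .n := by
        rw [h1, ← hg]; simp only [swap, map_inv, ← mul_inv, mul_comm (τ g.snd)]; rfl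
      rw [mul_of_swap this, h1]; simp [one_def]
    · have h1 : g⁻¹ = ⟨g.fst⁻¹, g.snd⁻¹⟩ := by rw [inv_def, if_neg (by simp [hg])]
      have : g⁻¹.swap = .s := by
        rw [h1, ← hg]; simp only [swap, map_inv, ← mul_inv]; rfl
      rw [mul_of_not_swap this, h1]; simp [one_def]

/-- The type of a pair. -/
def typ (τ : A →* Typ) : Ext τ →* Typ where
  toFun g := (τ g.fst * τ g.snd).shift
  map_one' := by simp only [one_def, map_one]; rfl
  map_mul' g h := by rw [typ_prod_mul]; exact map_mul shiftHom _ _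

theorem typ_apply (g : Ext τ) : typ τ g = (τ g.fst * τ g.snd).shift := rfl

/-- Pairs as elements of the product. -/
def equivProd (τ : A →* Typ) : Ext τ ≃ A × A where
  toFun g := (g.fst, g.snd)
  invFun p := ⟨p.1, p.2⟩
  left_inv _ := rfl
  right_inv _ := rfl

instance [Fintype A] : Fintype (Ext τ) := Fintype.ofEquiv _ (equivProd τ).symm

theorem card_eq [Fintype A] : Fintype.card (Ext τ) = Fintype.card A ^ 2 := by
  rw [Fintype.card_congr (equivProd τ), Fintype.card_prod, sq]

/-- The action on two copies of a set on which the sections act. -/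
def act {X : Type} (ρ : A →* Equiv.Perm X) : Ext τ →* Equiv.Perm (X ⊕ X) where
  toFun g := Equiv.sumCongr (ρ g.fst) (ρ g.snd) * if g.swap = .n then Equiv.sumComm X X else 1
  map_one' := by
    rw [swap_one]; ext (x | x) <;> simp [one_def]
  map_mul' g h := by
    rcases hg : g.swap <;> rcases hh : h.swap <;> rw [swap_mul, hg, hh] <;>
    first
      | rw [mul_of_swap hg]
        ext (x | x) <;> simp [show (Digit.n * Digit.n) = .s from rfl,
          show (Digit.n * Digit.s) = .n from rfl]
      | rw [mul_of_not_swap hg]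
        ext (x | x) <;> simp [show (Digit.s * Digit.s) = .s from rfl,
          show (Digit.s * Digit.n) = .n from rfl]

theorem act_of_swap {X : Type} (ρ : A →* Equiv.Perm X) {g : Ext τ} (hg : g.swap = .n) :
    act ρ g = Equiv.sumCongr (ρ g.fst) (ρ g.snd) * Equiv.sumComm X X := by
  simp [act, hg]

theorem act_of_not_swap {X : Type} (ρ : A →* Equiv.Perm X) {g : Ext τ} (hg : g.swap = .s) :
    act ρ g = Equiv.sumCongr (ρ g.fst) (ρ g.snd) := by
  simp [act, hg]

end Ext

/-- A finite group with a homomorphism to the group of types. -/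
structure TypedGroup where
  /-- the underlying set -/
  carrier : Type
  [group : Group carrier]
  [fintype : Fintype carrier]
  /-- the type homomorphism -/
  typ : carrier →* Typ

attribute [instance] TypedGroup.group TypedGroup.fintype

/-- The tower of iterated extensions of the group of types. -/
def tower : ℕ → TypedGroup
  | 0 => { carrier := Typ, typ := MonoidHom.id _ }
  | n + 1 => { carrier := Ext (tower n).typ, typ := Ext.typ (tower n).typ }

/-- The level `n` of the tower. -/
abbrev Tow (n : ℕ) : Type := (tower n).carrier

theorem card_tow (n : ℕ) : Fintype.card (Tow n) = 4 ^ 2 ^ n := by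
  induction n with
  | zero => rfl
  | succ n ih =>
    refine (Ext.card_eq (τ := (tower n).typ)).trans ?_
    rw [ih, ← pow_mul, pow_succ]

/-- Needed for the Frattini-type exchange of generators. -/
theorem isPGroup_tow (n : ℕ) : IsPGroup 2 (Tow n) := by
  refine IsPGroup.of_card (n := 2 * 2 ^ n) ?_
  rw [Nat.card_eq_fintype_card, card_tow, pow_mul]; norm_num

/-- The two halves of the set of leaves. -/
def halves (n : ℕ) : Fin (2 ^ n) ⊕ Fin (2 ^ n) ≃ Fin (2 ^ (n + 1)) :=
  finSumFinEquiv.trans (finCongr (by rw [pow_succ, mul_two]))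

@[simp] theorem halves_inl (n : ℕ) (i : Fin (2 ^ n)) : (halves n (.inl i)).val = i.val := rfl

@[simp] theorem halves_inr (n : ℕ) (i : Fin (2 ^ n)) :
    (halves n (.inr i)).val = 2 ^ n + i.val := rfl

/-- The action of the tower on the leaves of the trees. -/
def act : (n : ℕ) → Tow n →* Equiv.Perm (Fin (2 ^ n))
  | 0 => 1
  | n + 1 => (halves n).permCongrHom.toMonoidHom.comp (Ext.act (act n))

theorem act_succ (n : ℕ) (g : Ext (tower n).typ) :
    act (n + 1) g = (halves n).permCongr (Ext.act (act n) g) := rfl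

/-! ### Generators -/

/-- The product of the two digits of a type. -/
def digitProd : Typ →* Digit := MonoidHom.fst _ _ * MonoidHom.snd _ _

theorem odd_of_n_zpow {z : ℤ} (h : Digit.n ^ z = Digit.n) : Odd z := by
  by_contra hz
  obtain ⟨k, rfl⟩ := Int.not_odd_iff_even.1 hz
  rw [← two_mul, zpow_mul, show Digit.n ^ (2 : ℤ) = 1 from rfl, one_zpow] at h
  exact absurd h (by decide)

/-- If a finite `2`-group is generated by a set `S` and one element at which a homomorphism `ψ`
to the group of digits does not vanish, where `ψ` vanishes on `S`, then it is generated by `S` and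
any such element. -/
theorem closure_insert_eq_top_of_isPGroup {G : Type} [Group G] [Finite G] (hG : IsPGroup 2 G)
    (ψ : G →* Digit) {S : Set G} (hS : ∀ g ∈ S, ψ g = 1) {a b : G} (ha : ψ a = .n)
    (hb : ψ b = .n) (h : Subgroup.closure (insert a S) = ⊤) :
    Subgroup.closure (insert b S) = ⊤ := by
  by_contra hne
  -- If the new set did not generate, it would lie in a maximal subgroup `H`, which is normal by
  -- nilpotency and cannot contain `a`.
  obtain ⟨H, hH, hle⟩ := (eq_top_or_exists_le_coatom (Subgroup.closure (insert b S))).resolve_left hne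
  have hmem : ∀ g ∈ insert b S, g ∈ H := fun g hg => hle (Subgroup.subset_closure hg)
  have : Fact (Nat.Prime 2) := ⟨Nat.prime_two⟩
  have := hG.isNilpotent
  have haH : a ∉ H := fun haH => hH.1 <| top_le_iff.1 <| h ▸ (Subgroup.closure_le H).2 (by
    rintro g (rfl | hg)
    · exact haH
    · exact hmem g (.inr hg))
  have hn : H.Normal := Subgroup.NormalizerCondition.normal_of_coatom H
    Group.normalizerCondition_of_isNilpotent hH
  -- Modulo `H` every element is a power of `a`, and `ψ` reads off the parity of a suitable
  -- exponent.
  have key : ∀ g ∈ Subgroup.closure (insert a S), ∃ z : ℤ,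
      QuotientGroup.mk' H g = QuotientGroup.mk' H a ^ z ∧ ψ g = Digit.n ^ z := by
    intro g hg
    induction hg using Subgroup.closure_induction with
    | mem g hg =>
      rcases hg with rfl | hg
      · exact ⟨1, by simp, by simpa using ha⟩
      · refine ⟨0, ?_, by simpa using hS g hg⟩
        simpa using hmem g (.inr hg)
    | one => exact ⟨0, by simp, by simp⟩
    | mul g g' _ _ ih ih' =>
      obtain ⟨z, h1, h2⟩ := ih
      obtain ⟨z', h1', h2'⟩ := ih'
      exact ⟨z + z', by rw [map_mul, h1, h1', zpow_add], by rw [map_mul, h2, h2', zpow_add]⟩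
    | inv g _ ih =>
      obtain ⟨z, h1, h2⟩ := ih
      exact ⟨-z, by rw [map_inv, h1, zpow_neg], by rw [map_inv, h2, zpow_neg]⟩
  obtain ⟨z, h1, h2⟩ := key b (h ▸ Subgroup.mem_top b)
  have hz : Odd z := odd_of_n_zpow (h2.symm.trans hb)
  have hbH : QuotientGroup.mk' H b = 1 := (QuotientGroup.eq_one_iff b).2 (hmem b (.inl rfl))
  obtain ⟨k, hk⟩ := hG a
  -- `H` contains `a ^ z` with `z` odd, and `a` has 2-power order, so Bézout puts `a` itself in `H`.
  have hcop : IsCoprime z (2 ^ k) := by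
    refine IsCoprime.pow_right ?_
    obtain ⟨t, rfl⟩ := hz
    exact ⟨1, -t, by ring⟩
  obtain ⟨u, w, huw⟩ := hcop
  refine haH ((QuotientGroup.eq_one_iff a).1 ?_)
  change QuotientGroup.mk' H a = 1
  calc QuotientGroup.mk' H a = QuotientGroup.mk' H a ^ (u * z + w * 2 ^ k) := by rw [huw, zpow_one]
    _ = 1 := by
      rw [zpow_add, mul_comm u, zpow_mul, ← h1, hbH, one_zpow, one_mul, mul_comm w, zpow_mul,
        show (2 : ℤ) ^ k = ((2 ^ k : ℕ) : ℤ) by simp, zpow_natCast, ← map_pow, hk, map_one, one_zpow]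

namespace Ext

variable {A : Type} [Group A] {τ : A →* Typ}

/-- The elements whose second section is trivial. -/
def inFst (τ : A →* Typ) (h : A) : Ext τ := ⟨h, 1⟩

theorem swap_inFst (h : A) : (inFst τ h).swap = (τ h).2 := by simp [swap, inFst]

theorem typ_inFst (h : A) : typ τ (inFst τ h) = (τ h).shift := by simp [typ_apply, inFst]

theorem inFst_sq {h : A} (hh : (τ h).2 = .n) : inFst τ h ^ 2 = ⟨h, h⟩ := by
  rw [sq, mul_of_swap (by rw [swap_inFst, hh])]; simp [inFst]

/-- The standard generating set of an extension passes to the next extension. -/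
theorem closure_eq_top {x : A} (hx : τ x = nn) {V : Set A} (hV : ∀ v ∈ V, τ v = ss)
    {p : A} (hp : τ p = ns) (h : Subgroup.closure (insert p (insert x V)) = ⊤) :
    Subgroup.closure (insert (inFst τ p) (insert (inFst τ x)
      (insert (inFst τ (x ^ 2)) (inFst τ '' V)))) = ⊤ := by
  set G := Subgroup.closure (insert (inFst τ p) (insert (inFst τ x)
      (insert (inFst τ (x ^ 2)) (inFst τ '' V)))) with hG
  have hs : ∀ g ∈ insert (inFst τ p) (insert (inFst τ x)
      (insert (inFst τ (x ^ 2)) (inFst τ '' V))), g ∈ G := fun g hg => Subgroup.subset_closure hg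
  have hpG : inFst τ p ∈ G := hs _ (by simp)
  have hxG : inFst τ x ∈ G := hs _ (by simp)
  have hx2G : inFst τ (x ^ 2) ∈ G := hs _ (by simp)
  have hVG : ∀ v ∈ V, inFst τ v ∈ G := fun v hv =>
    hs _ (.inr (.inr (.inr (Set.mem_image_of_mem _ hv))))
  have hxx : (⟨x, x⟩ : Ext τ) ∈ G := by
    rw [← inFst_sq (τ := τ) (by rw [hx]; rfl)]; exact pow_mem hxG 2
  -- every element is the first section of an element of `G` that preserves the halves
  have hproj : ∀ g : A, ∃ k ∈ G, k.swap = .s ∧ k.fst = g := by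
    intro g
    have hg : g ∈ Subgroup.closure (insert p (insert x V)) := h ▸ Subgroup.mem_top g
    induction hg using Subgroup.closure_induction with
    | mem g hg =>
      rcases hg with rfl | rfl | hg
      · exact ⟨_, hpG, by rw [swap_inFst, hp]; rfl, rfl⟩
      · exact ⟨_, hxx, by rw [swap, hx]; rfl, rfl⟩
      · exact ⟨_, hVG g hg, by rw [swap_inFst, hV g hg]; rfl, rfl⟩
    | one => exact ⟨1, one_mem _, swap_one, rfl⟩
    | mul g g' _ _ ih ih' =>
      obtain ⟨k, hk, h1, h2⟩ := ih
      obtain ⟨k', hk', h1', h2'⟩ := ih'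
      refine ⟨k * k', mul_mem hk hk', by rw [swap_mul, h1, h1']; rfl, ?_⟩
      rw [mul_of_not_swap h1, h2, h2']
    | inv g _ ih =>
      obtain ⟨k, hk, h1, h2⟩ := ih
      have h3 : k⁻¹ = ⟨k.fst⁻¹, k.snd⁻¹⟩ := by rw [inv_def, if_neg (by simp [h1])]
      refine ⟨k⁻¹, inv_mem hk, ?_, by rw [h3, h2]⟩
      rw [h3, ← h1]; simp only [swap, map_inv, ← mul_inv]; rfl
  have hmul : ∀ {g g' : A}, (τ g).2 = .s → inFst τ g * inFst τ g' = inFst τ (g * g') := by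
    intro g g' hg
    rw [mul_of_not_swap (by rw [swap_inFst, hg])]; simp [inFst]
  -- Conjugation by an element of `G` that preserves the halves acts on a first section through its
  -- own first section alone, and that section is arbitrary.
  have hconj : ∀ g k : A, (τ k).2 = .s → inFst τ k ∈ G → inFst τ (g * k * g⁻¹) ∈ G := by
    intro g k hk hkG
    obtain ⟨t, ht, h1, rfl⟩ := hproj g
    have : inFst τ (t.fst * k * t.fst⁻¹) = t * inFst τ k * t⁻¹ := by
      rw [eq_mul_inv_iff_mul_eq, mul_of_not_swap h1, mul_of_not_swap]
      · simp [inFst]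
      · rw [swap_inFst, map_mul, map_mul, map_inv, mul_inv_cancel_comm, hk]
    rw [this]
    exact mul_mem (mul_mem ht hkG) (inv_mem ht)
  -- the kernel of the second digit embeds into `G`
  have hker : ∀ g : A, ∃ k : A, (τ k).2 = .s ∧ inFst τ k ∈ G ∧ (g = k ∨ g = x * k) := by
    intro g
    have hg : g ∈ Subgroup.closure (insert p (insert x V)) := h ▸ Subgroup.mem_top g
    have hpow : ∀ k : A, (τ k).2 = .s → inFst τ k ∈ G → inFst τ k⁻¹ ∈ G := by
      intro k hk hkG
      have : (inFst τ k)⁻¹ = inFst τ k⁻¹ := by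
        rw [inv_eq_iff_mul_eq_one, hmul hk, mul_inv_cancel]; rfl
      rw [← this]; exact inv_mem hkG
    have hτ2 : ∀ g g' : A, (τ (g * g')).2 = (τ g).2 * (τ g').2 := by simp
    have hτi : ∀ g : A, (τ g⁻¹).2 = (τ g).2 := by intro g; rw [map_inv]; rfl
    have hxs : (τ (x ^ 2)).2 = .s := by rw [map_pow, hx]; rfl
    have hcs : ∀ g k : A, (τ k).2 = .s → (τ (g * k * g⁻¹)).2 = .s := by
      intro g k hk; rw [map_mul, map_mul, map_inv, mul_inv_cancel_comm, hk]
    have hmulG : ∀ k k' : A, (τ k).2 = .s → inFst τ k ∈ G → inFst τ k' ∈ G →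
        inFst τ (k * k') ∈ G := fun k k' hk h1 h2 => hmul hk ▸ mul_mem h1 h2
    have hmuls : ∀ k k' : A, (τ k).2 = .s → (τ k').2 = .s → (τ (k * k')).2 = .s := by
      intro k k' hk hk'; rw [hτ2, hk, hk']; rfl
    induction hg using Subgroup.closure_induction with
    | mem g hg =>
      rcases hg with rfl | rfl | hg
      · exact ⟨g, by rw [hp]; rfl, hpG, .inl rfl⟩
      · exact ⟨1, by simp; rfl, one_mem _, .inr (by simp)⟩
      · exact ⟨g, by rw [hV g hg]; rfl, hVG g hg, .inl rfl⟩
    | one => exact ⟨1, by simp; rfl, one_mem _, .inl rfl⟩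
    | mul g g' _ _ ih ih' =>
      -- Rewriting with the coset representatives 1 and x: k(xk') = x(x⁻¹kx)k' and (xk)(xk') =
      -- x²(x⁻¹kx)k'. The second identity is why x² must occur among the generators.
      obtain ⟨k, hk, hkG, e | e⟩ := ih <;> obtain ⟨k', hk', hkG', e' | e'⟩ := ih'
      · exact ⟨_, hmuls _ _ hk hk', hmulG _ _ hk hkG hkG', .inl (by rw [e, e'])⟩
      · refine ⟨x⁻¹ * k * x⁻¹⁻¹ * k', hmuls _ _ (hcs _ _ hk) hk', hmulG _ _ (hcs _ _ hk)
          (hconj _ _ hk hkG) hkG', .inr (by rw [e, e']; group)⟩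
      · exact ⟨_, hmuls _ _ hk hk', hmulG _ _ hk hkG hkG', .inr (by rw [e, e']; group)⟩
      · refine ⟨x ^ 2 * (x⁻¹ * k * x⁻¹⁻¹ * k'), hmuls _ _ hxs (hmuls _ _ (hcs _ _ hk) hk'),
          hmulG _ _ hxs hx2G (hmulG _ _ (hcs _ _ hk) (hconj _ _ hk hkG) hkG'), .inl (by rw [e, e']; group)⟩
    | inv g _ ih =>
      obtain ⟨k, hk, hkG, e | e⟩ := ih
      · exact ⟨_, (hτi k).trans hk, hpow _ hk hkG, .inl (by rw [e])⟩
      · have hi : (τ k⁻¹).2 = .s := (hτi k).trans hk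
        have hxi : (τ (x ^ 2)⁻¹).2 = .s := (hτi _).trans hxs
        refine ⟨(x ^ 2)⁻¹ * (x * k⁻¹ * x⁻¹), hmuls _ _ hxi (hcs _ _ hi),
          hmulG _ _ hxi (hpow _ hxs hx2G) (hconj _ _ hi (hpow _ hk hkG)), .inr (by rw [e]; group)⟩
  have hker' : ∀ g : A, (τ g).2 = .s → inFst τ g ∈ G := by
    intro g hg
    obtain ⟨k, hk, hkG, rfl | rfl⟩ := hker g
    · exact hkG
    · rw [map_mul, Prod.snd_mul, hk, hx] at hg
      exact absurd hg (by decide)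
  -- The odometer exchanges the halves, so conjugation by it carries first sections to second
  -- sections.
  have hsnd : ∀ g : A, (τ g).2 = .s → (⟨1, g⟩ : Ext τ) ∈ G := by
    intro g hg
    have hsw : (inFst τ x).swap = .n := by rw [swap_inFst, hx]; rfl
    have : (⟨1, g⟩ : Ext τ) = inFst τ x * inFst τ g * (inFst τ x)⁻¹ := by
      rw [eq_mul_inv_iff_mul_eq, mul_of_swap hsw, mul_of_not_swap]
      · simp [inFst]
      · simp [swap, hg]
    rw [this]
    exact mul_mem (mul_mem hxG (hker' g hg)) (inv_mem hxG)
  have hss : ∀ g g' : A, (τ g).2 = .s → (τ g').2 = .s → (⟨g, g'⟩ : Ext τ) ∈ G := by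
    intro g g' hg hg'
    have : (⟨g, g'⟩ : Ext τ) = inFst τ g * ⟨1, g'⟩ := by
      rw [mul_of_not_swap (by rw [swap_inFst, hg])]; simp [inFst]
    rw [this]
    exact mul_mem (hker' g hg) (hsnd g' hg')
  have hnot : ∀ g : Ext τ, g.swap = .s → g ∈ G := by
    intro g hg
    rcases h1 : (τ g.fst).2
    · have h2 : (τ g.snd).2 = .n := by
        rw [swap, Prod.snd_mul, h1] at hg
        revert hg; generalize (τ g.snd).2 = d; revert d; decide
      -- If the halves are preserved, the second digits of the sections agree; when both are n,
      -- dividing by (x, x) makes both s.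
      have : g = ⟨x, x⟩ * ⟨x⁻¹ * g.fst, x⁻¹ * g.snd⟩ := by
        rw [mul_of_not_swap (by rw [swap, hx]; rfl)]; simp
      rw [this]
      refine mul_mem hxx (hss _ _ ?_ ?_)
      · rw [map_mul, Prod.snd_mul, h1, map_inv, hx]; rfl
      · rw [map_mul, Prod.snd_mul, h2, map_inv, hx]; rfl
    · refine hss _ _ h1 ?_
      rw [swap, Prod.snd_mul, h1] at hg
      revert hg; generalize (τ g.snd).2 = d; revert d; decide
  rw [eq_top_iff]
  intro g _
  rcases hg : g.swap
  · have : g = inFst τ x * ((inFst τ x)⁻¹ * g) := by simp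
    rw [this]
    refine mul_mem hxG (hnot _ ?_)
    have h1 : inFst τ x * ((inFst τ x)⁻¹ * g) = g := by simp
    have h2 := swap_mul (inFst τ x) ((inFst τ x)⁻¹ * g)
    rw [h1, hg, swap_inFst, hx] at h2
    revert h2; generalize ((inFst τ x)⁻¹ * g).swap = d; revert d; decide
  · exact hnot g hg

end Ext

/-- The odometers in the tower. -/
def odo : (n : ℕ) → Tow n
  | 0 => nn
  | n + 1 => Ext.inFst (tower n).typ (odo n)

/-- The squares of the odometers of the subtrees on the left edge of the tree. -/
def odoSquares : (n : ℕ) → Set (Tow n)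
  | 0 => ∅
  | n + 1 => insert (Ext.inFst (tower n).typ (odo n ^ 2)) (Ext.inFst (tower n).typ '' odoSquares n)

theorem typ_odo (n : ℕ) : (tower n).typ (odo n) = nn := by
  induction n with
  | zero => rfl
  | succ n ih =>
    refine (Ext.typ_inFst (τ := (tower n).typ) (odo n)).trans ?_
    rw [ih]; rfl

theorem typ_odoSquares (n : ℕ) : ∀ v ∈ odoSquares n, (tower n).typ v = ss := by
  induction n with
  | zero => intro v hv; exact hv.elim
  | succ n ih =>
    rintro v (rfl | ⟨w, hw, rfl⟩)
    · refine (Ext.typ_inFst (τ := (tower n).typ) _).trans ?_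
      rw [map_pow, typ_odo]; rfl
    · refine (Ext.typ_inFst (τ := (tower n).typ) _).trans ?_
      rw [ih w hw]; rfl

theorem typ_surjective (n : ℕ) : Function.Surjective (tower n).typ := by
  induction n with
  | zero => exact Function.surjective_id
  | succ n ih =>
    intro T
    obtain ⟨h, hh⟩ := ih T.shift
    refine ⟨Ext.inFst (tower n).typ h, (Ext.typ_inFst (τ := (tower n).typ) h).trans ?_⟩
    rw [hh]; rfl

/-- The inductive construction needs a generator of type ns but yields one of type sn. Both have
digit product n, while the other generators have types nn and ss, of digit product s; so the
exchange of generators in 2-groups closes the induction and leaves the choice of `g` free. -/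
theorem closure_tow_eq_top (n : ℕ) (g : Tow n) (hg : digitProd ((tower n).typ g) = .n) :
    Subgroup.closure (insert g (insert (odo n) (odoSquares n))) = ⊤ := by
  induction n with
  | zero =>
    rw [eq_top_iff]
    have h1 : g ∈ Subgroup.closure (insert g (insert (odo 0) (odoSquares 0))) :=
      Subgroup.subset_closure (by simp)
    have h2 : odo 0 ∈ Subgroup.closure (insert g (insert (odo 0) (odoSquares 0))) :=
      Subgroup.subset_closure (by simp)
    have : ∀ g t : Typ, digitProd g = .n → t = 1 ∨ t = g ∨ t = nn ∨ t = g * nn := by decide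
    intro t _
    rcases this g t hg with rfl | rfl | rfl | rfl
    · exact one_mem _
    · exact h1
    · exact h2
    · exact mul_mem h1 h2
  | succ n ih =>
    obtain ⟨p, hp⟩ := typ_surjective n ns
    have hψ : ∀ k ∈ insert (odo (n + 1)) (odoSquares (n + 1)),
        (digitProd.comp (tower (n + 1)).typ) k = 1 := by
      rintro k (rfl | hk)
      · rw [MonoidHom.comp_apply, typ_odo]; rfl
      · rw [MonoidHom.comp_apply, typ_odoSquares _ k hk]; rfl
    refine closure_insert_eq_top_of_isPGroup (isPGroup_tow (n + 1)) _ hψ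
      (a := Ext.inFst (tower n).typ p) ?_ hg ?_
    · refine (congrArg digitProd (Ext.typ_inFst (τ := (tower n).typ) p)).trans ?_
      rw [hp]; rfl
    · exact Ext.closure_eq_top (typ_odo n) (typ_odoSquares n) hp (ih p (by rw [hp]; rfl))

/-! ### The generators as images of elements of the tower -/

/-- The permutations of the leaves of the left subtree as permutations of all leaves. -/
def leftHalf (n : ℕ) : Equiv.Perm (Fin (2 ^ n)) →* Equiv.Perm (Fin (2 ^ (n + 1))) where
  toFun g := (halves n).permCongr (Equiv.sumCongr g 1)
  map_one' := by
    apply Equiv.ext; intro y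
    obtain ⟨y | y, rfl⟩ := (halves n).surjective y <;> simp
  map_mul' g h := by
    apply Equiv.ext; intro y
    obtain ⟨y | y, rfl⟩ := (halves n).surjective y <;> simp

@[simp] theorem leftHalf_inl (n : ℕ) (g : Equiv.Perm (Fin (2 ^ n))) (y : Fin (2 ^ n)) :
    leftHalf n g (halves n (.inl y)) = halves n (.inl (g y)) := by
  simp [leftHalf]

@[simp] theorem leftHalf_inr (n : ℕ) (g : Equiv.Perm (Fin (2 ^ n))) (y : Fin (2 ^ n)) :
    leftHalf n g (halves n (.inr y)) = halves n (.inr y) := by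
  simp [leftHalf]

section act

variable {n : ℕ} {g : Ext (tower n).typ}

theorem act_inl_of_swap (h : g.swap = .n) (y : Fin (2 ^ n)) :
    act (n + 1) g (halves n (.inl y)) = halves n (.inr (act n g.snd y)) := by
  rw [act_succ, Ext.act_of_swap _ h]; simp

theorem act_inr_of_swap (h : g.swap = .n) (y : Fin (2 ^ n)) :
    act (n + 1) g (halves n (.inr y)) = halves n (.inl (act n g.fst y)) := by
  rw [act_succ, Ext.act_of_swap _ h]; simp

theorem act_inl_of_not_swap (h : g.swap = .s) (y : Fin (2 ^ n)) :
    act (n + 1) g (halves n (.inl y)) = halves n (.inl (act n g.fst y)) := by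
  rw [act_succ, Ext.act_of_not_swap _ h]; simp

theorem act_inr_of_not_swap (h : g.swap = .s) (y : Fin (2 ^ n)) :
    act (n + 1) g (halves n (.inr y)) = halves n (.inr (act n g.snd y)) := by
  rw [act_succ, Ext.act_of_not_swap _ h]; simp

end act

theorem a_val {n j : ℕ} (hj : 1 ≤ j ∧ j ≤ n) (i : Fin (2 ^ n)) :
    (a n j i).val = swapHalves j i.val := by
  simp [a, hj]

theorem a_succ {n j : ℕ} (hj : 1 ≤ j ∧ j ≤ n) : a (n + 1) j = leftHalf n (a n j) := by
  have h : 2 ^ (j - 1) + 2 ^ (j - 1) ≤ 2 ^ n := by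
    rw [← two_mul, ← pow_succ', Nat.sub_add_cancel hj.1]
    exact Nat.pow_le_pow_right (by norm_num) hj.2
  apply Equiv.ext; intro y
  apply Fin.ext
  rw [a_val ⟨hj.1, hj.2.trans n.le_succ⟩]
  obtain ⟨y | y, rfl⟩ := (halves n).surjective y
  · rw [leftHalf_inl, halves_inl, halves_inl, a_val hj]
  · rw [leftHalf_inr, halves_inr, swapHalves]
    split_ifs <;> omega

theorem a_self_inl (n : ℕ) (y : Fin (2 ^ n)) :
    a (n + 1) (n + 1) (halves n (.inl y)) = halves n (.inr y) := by
  apply Fin.ext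
  rw [a_val ⟨by omega, le_rfl⟩, halves_inl, halves_inr, swapHalves, Nat.add_sub_cancel,
    if_pos y.isLt, add_comm]

theorem a_self_inr (n : ℕ) (y : Fin (2 ^ n)) :
    a (n + 1) (n + 1) (halves n (.inr y)) = halves n (.inl y) := by
  apply Fin.ext
  have := y.isLt
  rw [a_val ⟨by omega, le_rfl⟩, halves_inl, halves_inr, swapHalves, Nat.add_sub_cancel,
    if_neg (by omega), if_pos (by omega), Nat.add_sub_cancel_left]

theorem x_succ {n k : ℕ} (hk : k ≤ n) : x (n + 1) k = leftHalf n (x n k) := by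
  induction k with
  | zero => exact (map_one _).symm
  | succ k ih =>
    rw [x, x, ih (by omega), a_succ ⟨by omega, hk⟩, map_mul]

theorem act_inFst_of_not_swap {n : ℕ} (h : Tow n) (hh : ((tower n).typ h).2 = .s) :
    act (n + 1) (Ext.inFst (tower n).typ h) = leftHalf n (act n h) := by
  have hs : (Ext.inFst (tower n).typ h).swap = .s := by rw [Ext.swap_inFst, hh]
  apply Equiv.ext; intro y
  obtain ⟨y | y, rfl⟩ := (halves n).surjective y
  · rw [act_inl_of_not_swap hs, leftHalf_inl]; rfl
  · rw [act_inr_of_not_swap hs, leftHalf_inr]; simp [Ext.inFst]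

theorem act_odo (n : ℕ) : act n (odo n) = x n n := by
  induction n with
  | zero => rfl
  | succ n ih =>
    have hs : (Ext.inFst (tower n).typ (odo n)).swap = .n := by
      rw [Ext.swap_inFst, typ_odo]; rfl
    rw [x, x_succ le_rfl, ← ih]
    apply Equiv.ext; intro y
    obtain ⟨y | y, rfl⟩ := (halves n).surjective y
    · refine (act_inl_of_swap hs y).trans ?_
      rw [Equiv.Perm.mul_apply, a_self_inl, leftHalf_inr]; simp [Ext.inFst]
    · refine (act_inr_of_swap hs y).trans ?_
      rw [Equiv.Perm.mul_apply, a_self_inr, leftHalf_inl]; rfl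

theorem v_succ {n i : ℕ} (hi : i + 2 ≤ n) : v (n + 1) i = leftHalf n (v n i) := by
  rw [v, v, x_succ hi, map_pow]

theorem act_inFst_odo_sq (n : ℕ) :
    act (n + 1) (Ext.inFst (tower n).typ (odo n ^ 2)) = leftHalf n (x n n ^ 2) := by
  rw [act_inFst_of_not_swap, map_pow, act_odo]
  rw [map_pow, typ_odo]; rfl

/-- The squares of the odometers of heights 0 and 1 are trivial; those of height i + 2 < n are the
`v n i`. -/
theorem act_odoSquares (n : ℕ) :
    ∀ w ∈ odoSquares n, act n w = 1 ∨ ∃ i, i + 3 ≤ n ∧ act n w = v n i := by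
  induction n with
  | zero => intro w hw; exact hw.elim
  | succ n ih =>
    rintro w (rfl | ⟨w, hw, rfl⟩)
    · rw [act_inFst_odo_sq]
      match n with
      | 0 => exact .inl (by rw [x]; simp)
      | 1 =>
        refine .inl ?_
        rw [show x 1 1 ^ 2 = 1 by decide, map_one]
      | n + 2 =>
        refine .inr ⟨n, by omega, ?_⟩
        rw [v_succ le_rfl]; rfl
    · rw [act_inFst_of_not_swap _ (by rw [typ_odoSquares n w hw]; rfl)]
      rcases ih w hw with h | ⟨i, hi, h⟩
      · exact .inl (by rw [h, map_one])
      · exact .inr ⟨i, by omega, by rw [h, v_succ (by omega)]⟩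

theorem exists_act_eq_v {n i : ℕ} (hi : i + 3 ≤ n) : ∃ w ∈ odoSquares n, act n w = v n i := by
  induction n with
  | zero => omega
  | succ n ih =>
    rcases Nat.lt_or_ge n (i + 3) with h | h
    · obtain rfl : n = i + 2 := by omega
      exact ⟨_, Set.mem_insert _ _, by rw [act_inFst_odo_sq, v_succ le_rfl]; rfl⟩
    · obtain ⟨w, hw, h'⟩ := ih h
      refine ⟨_, Set.mem_insert_of_mem _ (Set.mem_image_of_mem _ hw), ?_⟩
      rw [act_inFst_of_not_swap _ (by rw [typ_odoSquares n w hw]; rfl), h', v_succ (by omega)]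

/-! ### Leaf labels and truncation -/

/-- The element of the tower with given types at the leaves. -/
def ofLabels : (n : ℕ) → (ℕ → Typ) → Tow n
  | 0, f => f 0
  | n + 1, f => (⟨ofLabels n f, ofLabels n fun k => f (k + 2 ^ n)⟩ : Ext (tower n).typ)

/-- The labels of the parents of the leaves. -/
def coarsen (f : ℕ → Typ) (k : ℕ) : Typ := (f (2 * k) * f (2 * k + 1)).shift

theorem ofLabels_congr {n : ℕ} {f g : ℕ → Typ} (h : ∀ k < 2 ^ n, f k = g k) :
    ofLabels n f = ofLabels n g := by
  induction n generalizing f g with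
  | zero => exact h 0 (by simp)
  | succ n ih =>
    have h2 : 2 ^ (n + 1) = 2 ^ n + 2 ^ n := by rw [pow_succ, mul_two]
    exact Ext.ext (τ := (tower n).typ) (ih fun k hk => h k (by omega))
      (ih fun k hk => h _ (by omega))

theorem ofLabels_surjective (n : ℕ) : Function.Surjective (ofLabels n) := by
  induction n with
  | zero => exact fun T => ⟨fun _ => T, rfl⟩
  | succ n ih =>
    intro w
    obtain ⟨f, hf⟩ := ih (Ext.fst (τ := (tower n).typ) w)
    obtain ⟨g, hg⟩ := ih (Ext.snd (τ := (tower n).typ) w)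
    refine ⟨fun k => if k < 2 ^ n then f k else g (k - 2 ^ n), ?_⟩
    refine Ext.ext (τ := (tower n).typ) ?_ ?_
    · rw [← hf]
      exact ofLabels_congr fun k hk => if_pos hk
    · rw [← hg]
      exact ofLabels_congr fun k hk => by simp

/-- The tower grows at the root, the Markov map at the leaves. Cutting off the lowest level leaves
the type at the root unchanged. -/
theorem typ_ofLabels_succ (n : ℕ) (f : ℕ → Typ) :
    (tower (n + 1)).typ (ofLabels (n + 1) f) = (tower n).typ (ofLabels n (coarsen f)) := by
  induction n generalizing f with
  | zero => rfl
  | succ n ih =>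
    have h1 := ih f
    have h2 := ih fun k => f (k + 2 ^ (n + 1))
    have h3 : coarsen (fun k => f (k + 2 ^ (n + 1))) = fun k => coarsen f (k + 2 ^ n) := by
      funext k
      simp only [coarsen, pow_succ]
      congr 3 <;> ring
    refine (Ext.typ_apply (τ := (tower (n + 1)).typ) _).trans ?_
    refine Eq.trans ?_ (Ext.typ_apply (τ := (tower n).typ) _).symm
    refine congrArg Typ.shift (congrArg₂ _ h1 (h2.trans ?_))
    rw [h3]; rfl

theorem childEquiv_val (n : ℕ) (i : Fin (2 ^ n)) (b : Fin 2) :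
    (childEquiv n (i, b)).val = b.val + 2 * i.val := rfl

theorem childEquiv_inl (n : ℕ) (i : Fin (2 ^ n)) (b : Fin 2) :
    childEquiv (n + 1) (halves n (.inl i), b) = halves (n + 1) (.inl (childEquiv n (i, b))) := rfl

theorem childEquiv_inr (n : ℕ) (i : Fin (2 ^ n)) (b : Fin 2) :
    childEquiv (n + 1) (halves n (.inr i), b) = halves (n + 1) (.inr (childEquiv n (i, b))) := by
  apply Fin.ext
  rw [childEquiv_val, halves_inr, halves_inr, childEquiv_val, pow_succ]; ring

/-- Truncation is compatible with the action, and the sheet change is decided at the target vertex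
because sections are indexed by the half into which they map. The exchange digit of a pair is the
first digit of the parent's label, as `coarsen` shifts. -/
theorem act_ofLabels_succ (n : ℕ) (f : ℕ → Typ) (j : Fin (2 ^ n)) (b : Fin 2) :
    act (n + 1) (ofLabels (n + 1) f) (childEquiv n (j, b)) =
      childEquiv n (act n (ofLabels n (coarsen f)) j,
        if (coarsen f (act n (ofLabels n (coarsen f)) j).val).1 = .n then Equiv.swap 0 1 b
        else b) := by
  induction n generalizing f with
  | zero =>
    obtain rfl : j = 0 := Fin.ext (Nat.lt_one_iff.1 j.isLt)
    have hb : childEquiv 0 (0, 0) = halves 0 (.inl 0) ∧ childEquiv 0 (0, 1) = halves 0 (.inr 0) := by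
      decide
    have h0 : act 0 (ofLabels 0 (coarsen f)) 0 = 0 := rfl
    rw [h0]
    have hs : Ext.swap (τ := (tower 0).typ) (ofLabels 1 f) = (coarsen f 0).1 := rfl
    rcases h : (coarsen f 0).1 <;> rw [h] at hs <;> fin_cases b
    · refine ((congrArg _ hb.1).trans (act_inl_of_swap hs 0)).trans ?_
      simp [h, hb]; rfl
    · refine ((congrArg _ hb.2).trans (act_inr_of_swap hs 0)).trans ?_
      simp [h, hb]; rfl
    · refine ((congrArg _ hb.1).trans (act_inl_of_not_swap hs 0)).trans ?_
      simp [h, hb]; rfl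
    · refine ((congrArg _ hb.2).trans (act_inr_of_not_swap hs 0)).trans ?_
      simp [h, hb]; rfl
  | succ n ih =>
    have h3 : coarsen (fun k => f (k + 2 ^ (n + 1))) = fun k => coarsen f (k + 2 ^ n) := by
      funext k
      simp only [coarsen, pow_succ]
      congr 3 <;> ring
    have hs : Ext.swap (τ := (tower (n + 1)).typ) (ofLabels (n + 2) f) =
        Ext.swap (τ := (tower n).typ) (ofLabels (n + 1) (coarsen f)) :=
      congrArg Prod.fst (typ_ofLabels_succ (n + 1) f)
    have h1 := ih f
    have h2 := ih fun k => f (k + 2 ^ (n + 1))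
    rw [h3] at h2
    have hadd : ∀ i : Fin (2 ^ n), (halves n (.inr i)).val = i.val + 2 ^ n := fun i => add_comm _ _
    rcases h : Ext.swap (τ := (tower n).typ) (ofLabels (n + 1) (coarsen f)) <;> rw [h] at hs <;>
      obtain ⟨j | j, rfl⟩ := (halves n).surjective j
    · refine ((congrArg _ (childEquiv_inl n j b)).trans (act_inl_of_swap hs _)).trans ?_
      refine (congrArg (fun y => halves (n + 1) (.inr y)) (h2 j)).trans ?_
      rw [← childEquiv_inr, act_inl_of_swap h j, hadd]; rfl
    · refine ((congrArg _ (childEquiv_inr n j b)).trans (act_inr_of_swap hs _)).trans ?_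
      refine (congrArg (fun y => halves (n + 1) (.inl y)) (h1 j)).trans ?_
      rw [← childEquiv_inl, act_inr_of_swap h j]; rfl
    · refine ((congrArg _ (childEquiv_inl n j b)).trans (act_inl_of_not_swap hs _)).trans ?_
      refine (congrArg (fun y => halves (n + 1) (.inl y)) (h1 j)).trans ?_
      rw [← childEquiv_inl, act_inl_of_not_swap h j]; rfl
    · refine ((congrArg _ (childEquiv_inr n j b)).trans (act_inr_of_not_swap hs _)).trans ?_
      refine (congrArg (fun y => halves (n + 1) (.inr y)) (h2 j)).trans ?_
      rw [← childEquiv_inr, act_inr_of_not_swap h j, hadd]; rfl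

/-! ### The Markov map in terms of labels -/

namespace TypedPerm

variable {n : ℕ} (X : TypedPerm n)

/-- A leaf that is the smallest one of its cycle. -/
def IsMin (i : Fin (2 ^ n)) : Prop := ∀ k, X.perm.SameCycle i k → i ≤ k

theorem crossing_iff (i : Fin (2 ^ n)) : X.Crossing i ↔ (X.type i).1 = .n ∧ X.IsMin i := Iff.rfl

open Classical in
theorem liftPerm_childEquiv (i : Fin (2 ^ n)) (b : Fin 2) :
    X.liftPerm (childEquiv n (i, b)) =
      childEquiv n (X.perm i, if X.Crossing (X.perm i) then Equiv.swap 0 1 b else b) := by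
  simp only [liftPerm, Equiv.permCongr_apply, Equiv.symm_apply_apply, Equiv.prodShear_apply]
  split_ifs <;> rfl

theorem liftPerm_pow_fst (t : ℕ) (i : Fin (2 ^ n)) (b : Fin 2) :
    ∃ b', (X.liftPerm ^ t) (childEquiv n (i, b)) = childEquiv n ((X.perm ^ t) i, b') := by
  induction t with
  | zero => exact ⟨b, rfl⟩
  | succ t ih =>
    obtain ⟨b', h⟩ := ih
    rw [pow_succ' X.liftPerm, Equiv.Perm.mul_apply, h, liftPerm_childEquiv, pow_succ' X.perm,
      Equiv.Perm.mul_apply]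
    exact ⟨_, rfl⟩

theorem liftPerm_pow_of_not_crossing {t : ℕ} {i : Fin (2 ^ n)} (b : Fin 2)
    (h : ∀ u < t, ¬ X.Crossing ((X.perm ^ (u + 1)) i)) :
    (X.liftPerm ^ t) (childEquiv n (i, b)) = childEquiv n ((X.perm ^ t) i, b) := by
  induction t with
  | zero => rfl
  | succ t ih =>
    rw [pow_succ' X.liftPerm, Equiv.Perm.mul_apply, ih fun u hu => h u (by omega),
      liftPerm_childEquiv, ← Equiv.Perm.mul_apply X.perm, ← pow_succ' X.perm, if_neg (h t (by omega))]

theorem type_pow (t : ℕ) (i : Fin (2 ^ n)) : X.type ((X.perm ^ t) i) = X.type i := by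
  induction t with
  | zero => rfl
  | succ t ih => rw [pow_succ', Equiv.Perm.mul_apply, X.type_perm, ih]

theorem isMin_of_isMin_child {i : Fin (2 ^ n)} {b : Fin 2}
    (h : (markovMap X).IsMin (childEquiv n (i, b))) : X.IsMin i := by
  intro k hk
  obtain ⟨t, rfl⟩ := hk.exists_nat_pow_eq
  obtain ⟨b', hb'⟩ := X.liftPerm_pow_fst t i b
  have : childEquiv n (i, b) ≤ childEquiv n ((X.perm ^ t) i, b') :=
    h _ ⟨t, by rw [zpow_natCast]; exact hb'⟩
  rw [Fin.le_def, childEquiv_val, childEquiv_val] at this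
  rw [Fin.le_def]; omega

theorem isMin_child_zero {i : Fin (2 ^ n)} (h : X.IsMin i) :
    (markovMap X).IsMin (childEquiv n (i, 0)) := by
  intro l hl
  obtain ⟨t, rfl⟩ := hl.exists_nat_pow_eq
  obtain ⟨b', hb'⟩ := X.liftPerm_pow_fst t i 0
  have h1 := h _ ⟨t, by rw [zpow_natCast]⟩
  change _ ≤ (X.liftPerm ^ t) _
  rw [hb', Fin.le_def, childEquiv_val, childEquiv_val]
  rw [Fin.le_def] at h1
  simp; omega

theorem isMin_child_one_of_s {i : Fin (2 ^ n)} (h : X.IsMin i) (hs : (X.type i).1 = .s) :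
    (markovMap X).IsMin (childEquiv n (i, 1)) := by
  intro l hl
  obtain ⟨t, rfl⟩ := hl.exists_nat_pow_eq
  have hb' := X.liftPerm_pow_of_not_crossing (t := t) (i := i) 1 fun u _ hc => by
    have := hc.1
    rw [type_pow, hs] at this
    exact absurd this (by decide)
  have h1 := h _ ⟨t, by rw [zpow_natCast]⟩
  change _ ≤ (X.liftPerm ^ t) _
  rw [hb', Fin.le_def, childEquiv_val, childEquiv_val]
  rw [Fin.le_def] at h1
  omega

/-- In a doubling, one turn around the cycle crosses exactly once, on the return to the minimum, and
so joins the child 1 of the minimum to its smaller child 0. -/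
theorem not_isMin_child_one {i : Fin (2 ^ n)} (hn : (X.type i).1 = .n) :
    ¬ (markovMap X).IsMin (childEquiv n (i, 1)) := by
  intro h
  have hi := X.isMin_of_isMin_child h
  obtain ⟨d, hd, hdi⟩ : ∃ d, Function.minimalPeriod X.perm i = d + 1 ∧ (X.perm ^ (d + 1)) i = i := by
    have : 0 < Function.minimalPeriod X.perm i :=
      Function.minimalPeriod_pos_of_mem_periodicPts
        (Function.Injective.mem_periodicPts X.perm.injective i)
    refine ⟨Function.minimalPeriod X.perm i - 1, by omega, ?_⟩
    rw [Nat.sub_add_cancel this, ← Equiv.Perm.iterate_eq_pow]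
    exact Function.iterate_minimalPeriod
  -- A crossing within the first `d` steps would be a return to the minimum before the full period
  -- `d + 1`.
  have h1 := X.liftPerm_pow_of_not_crossing (t := d) (i := i) 1 fun u hu hc => by
    have h2 : (X.perm ^ (u + 1)) i ≤ i :=
      hc.2 _ (Equiv.Perm.SameCycle.symm ⟨(u + 1 : ℕ), by rw [zpow_natCast]⟩)
    have h3 : (X.perm ^ (u + 1)) i = i :=
      le_antisymm h2 (hi _ ⟨(u + 1 : ℕ), by rw [zpow_natCast]⟩)
    rw [← Equiv.Perm.iterate_eq_pow] at h3
    have := Function.IsPeriodicPt.minimalPeriod_le (f := X.perm) (x := i) (by omega) h3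
    omega
  have h4 : (X.liftPerm ^ (d + 1)) (childEquiv n (i, 1)) = childEquiv n (i, 0) := by
    rw [pow_succ' X.liftPerm, Equiv.Perm.mul_apply, h1, liftPerm_childEquiv,
      ← Equiv.Perm.mul_apply X.perm, ← pow_succ' X.perm, hdi, if_pos ⟨hn, hi⟩]
    simp
  have : childEquiv n (i, 1) ≤ childEquiv n (i, 0) :=
    h _ ⟨(d + 1 : ℕ), by rw [zpow_natCast]; exact h4⟩
  rw [Fin.le_def, childEquiv_val, childEquiv_val] at this
  simp at this

open Classical in
/-- The types of the cycles, put at their smallest elements. -/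
noncomputable def labels (k : ℕ) : Typ :=
  if h : k < 2 ^ n then if X.IsMin ⟨k, h⟩ then X.type ⟨k, h⟩ else ss else ss

theorem labels_of_isMin {i : Fin (2 ^ n)} (h : X.IsMin i) : X.labels i = X.type i := by
  simp [labels, h]

theorem labels_of_not_isMin {i : Fin (2 ^ n)} (h : ¬ X.IsMin i) : X.labels i = ss := by
  simp [labels, h]

theorem labels_of_ge {k : ℕ} (h : 2 ^ n ≤ k) : X.labels k = ss := by
  simp [labels, Nat.not_lt.2 h]

/-- The children produced by the Markov map have types whose product is f of the parent's type, and
f is an involution. For a doubling, only child 0 of the minimum carries a type; child 1 contributes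
the identity ss. -/
theorem coarsen_labels : coarsen (markovMap X).labels = X.labels := by
  funext k
  rcases Nat.lt_or_ge k (2 ^ n) with hk | hk
  · obtain ⟨i, rfl⟩ : ∃ i : Fin (2 ^ n), k = i.val := ⟨⟨k, hk⟩, rfl⟩
    have h0 : 2 * i.val = (childEquiv n (i, 0)).val := by simp [childEquiv_val]
    have h1 : 2 * i.val + 1 = (childEquiv n (i, 1)).val := by simp [childEquiv_val]; omega
    have ht (b : Fin 2) : (markovMap X).type (childEquiv n (i, b)) = restrictedChild (X.type i) b := by
      simp [markovMap, liftType]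
    rw [coarsen, h1, h0]
    by_cases hi : X.IsMin i
    · rw [labels_of_isMin _ (X.isMin_child_zero hi), X.labels_of_isMin hi, ht]
      rcases hT : (X.type i).1
      · rw [labels_of_not_isMin _ (X.not_isMin_child_one hT)]
        clear ht
        generalize X.type i = T at *; revert T; decide
      · rw [labels_of_isMin _ (X.isMin_child_one_of_s hi hT), ht]
        clear ht
        generalize X.type i = T at *; revert T; decide
    · rw [X.labels_of_not_isMin hi,
        labels_of_not_isMin _ fun h => hi (X.isMin_of_isMin_child h),
        labels_of_not_isMin _ fun h => hi (X.isMin_of_isMin_child h)]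
      rfl
  · have : 2 ^ (n + 1) ≤ 2 * k := by rw [pow_succ]; omega
    rw [coarsen, labels_of_ge _ this, labels_of_ge _ (by omega), labels_of_ge _ hk]
    rfl

theorem act_labels_markovMap (h : act n (ofLabels n X.labels) = X.perm) :
    act (n + 1) (ofLabels (n + 1) (markovMap X).labels) = (markovMap X).perm := by
  apply Equiv.ext; intro y
  obtain ⟨⟨j, b⟩, rfl⟩ := (childEquiv n).surjective y
  rw [act_ofLabels_succ, coarsen_labels, h]
  refine Eq.trans ?_ (X.liftPerm_childEquiv j b).symm
  congr 2
  by_cases hm : X.IsMin (X.perm j)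
  · simp [labels_of_isMin _ hm, crossing_iff, hm]
  · simp [labels_of_not_isMin _ hm, crossing_iff, hm, ss]

end TypedPerm

/-! ### Lifts of the generators `m n`, and the image of the tower -/

theorem ofLabels_mTypedTwo :
    ofLabels 2 mTypedTwo.labels = ofLabels 2 fun k => if k = 0 then sn else ss := by
  have hsc : mTypedTwo.perm.SameCycle 1 0 := ⟨1, by decide⟩
  refine ofLabels_congr fun k hk => ?_
  by_cases h : mTypedTwo.IsMin ⟨k, hk⟩
  · refine (mTypedTwo.labels_of_isMin h).trans ?_
    obtain rfl | rfl | hk' : k = 0 ∨ k = 1 ∨ 2 ≤ k := by omega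
    · rfl
    · exact absurd (h 0 hsc) (by simp)
    · rw [if_neg (by omega)]; exact if_neg (by simpa using show 1 < k from hk')
  · refine (mTypedTwo.labels_of_not_isMin h).trans (if_neg ?_).symm
    rintro rfl
    exact h fun l _ => Fin.zero_le l

theorem act_mTyped (k : ℕ) :
    act (k + 2) (ofLabels (k + 2) (mTyped k).labels) = (mTyped k).perm := by
  induction k with
  | zero =>
    refine (congrArg (act 2) ofLabels_mTypedTwo).trans ?_
    decide
  | succ k ih => exact (mTyped k).act_labels_markovMap ih

theorem typ_mTyped (k : ℕ) : (tower (k + 2)).typ (ofLabels (k + 2) (mTyped k).labels) = sn := by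
  induction k with
  | zero => exact (congrArg (tower 2).typ ofLabels_mTypedTwo).trans (by decide)
  | succ k ih =>
    refine (typ_ofLabels_succ _ _).trans ?_
    rw [← ih, mTyped, TypedPerm.coarsen_labels]

theorem exists_act_eq_m {n : ℕ} (hn : 1 ≤ n) :
    ∃ w : Tow n, act n w = m n ∧ digitProd ((tower n).typ w) = .n := by
  match n with
  -- The exchange digit of (ns, ss) is s, so it acts trivially, yet its type is sn.
  | 1 => exact ⟨(⟨ns, ss⟩ : Ext (tower 0).typ), by decide, by decide⟩
  | k + 2 => exact ⟨_, act_mTyped k, by rw [typ_mTyped]; rfl⟩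

theorem range_act {n : ℕ} (hn : 1 ≤ n) : (act n).range = M n := by
  obtain ⟨w, hw, hψ⟩ := exists_act_eq_m hn
  rw [MonoidHom.range_eq_map, ← closure_tow_eq_top n w hψ, MonoidHom.map_closure]
  apply le_antisymm
  · rw [Subgroup.closure_le]
    rintro _ ⟨g, rfl | rfl | hg, rfl⟩
    · exact Subgroup.subset_closure (.inl (.inr hw))
    · exact Subgroup.subset_closure (.inl (.inl (act_odo n)))
    · rcases act_odoSquares n g hg with h | ⟨i, hi, h⟩
      · rw [h]; exact one_mem _
      · exact Subgroup.subset_closure (.inr ⟨i, hi, h⟩)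
  · refine Subgroup.closure_mono ?_
    rintro g ((rfl | rfl) | ⟨i, hi, rfl⟩)
    · exact ⟨_, .inr (.inl rfl), act_odo n⟩
    · exact ⟨_, .inl rfl, hw⟩
    · obtain ⟨u, hu, h⟩ := exists_act_eq_v hi
      exact ⟨u, .inr (.inr hu), h⟩

/-- Halving a leaf number passes to the parent, on which the truncated element acts; for `k = 0` the
condition is injectivity. -/
theorem act_mem_treeAut (n : ℕ) (w : Tow n) : act n w ∈ treeAut n := by
  induction n with
  | zero =>
    intro k i j
    have h0 : ∀ i : Fin (2 ^ 0), i.val = 0 := fun i => Nat.lt_one_iff.1 i.isLt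
    simp only [h0]
  | succ n ih =>
    obtain ⟨f, rfl⟩ := ofLabels_surjective (n + 1) w
    intro k i j
    cases k with
    | zero => simp [Fin.val_inj]
    | succ k =>
      have key : ∀ i, (act (n + 1) (ofLabels (n + 1) f) i).val / 2 =
          (act n (ofLabels n (coarsen f)) ((childEquiv n).symm i).1).val := by
        intro i
        obtain ⟨⟨i, b⟩, rfl⟩ := (childEquiv n).surjective i
        rw [act_ofLabels_succ, childEquiv_val, Equiv.symm_apply_apply]
        dsimp only; omega
      have key' : ∀ i, i.val / 2 = ((childEquiv n).symm i).1.val := by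
        intro i
        obtain ⟨⟨i, b⟩, rfl⟩ := (childEquiv n).surjective i
        rw [childEquiv_val, Equiv.symm_apply_apply]
        dsimp only; omega
      simp only [pow_succ' 2 k, ← Nat.div_div_eq_div_mul, key, key']
      exact ih _ k _ _

/-! ### Cycle types in terms of minimal periods -/

section Cycles

open Function

variable {α β : Type}

theorem minimalPeriod_perm_pos [Finite α] (σ : Equiv.Perm α) (i : α) : 0 < minimalPeriod σ i :=
  minimalPeriod_pos_of_mem_periodicPts (Injective.mem_periodicPts σ.injective i)

/-- A power of a cycle is trivial as soon as it fixes one moved point, so the period of a point is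
the order of its cycle. Counting points by period then replaces handling cycle decompositions of
sums and exchanges. -/
theorem minimalPeriod_eq_card_support_cycleOf [Fintype α] [DecidableEq α]
    (σ : Equiv.Perm α) {i : α} (hi : σ i ≠ i) :
    minimalPeriod σ i = (σ.cycleOf i).support.card := by
  refine Nat.dvd_right_iff_eq.1 fun k => ?_
  rw [← isPeriodicPt_iff_minimalPeriod_dvd, IsPeriodicPt, IsFixedPt, Equiv.Perm.iterate_eq_pow,
    ← (Equiv.Perm.isCycle_cycleOf σ hi).orderOf, orderOf_dvd_iff_pow_eq_one,
    (Equiv.Perm.isCycle_cycleOf σ hi).pow_eq_one_iff' (x := i) (by simpa using hi),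
    Equiv.Perm.cycleOf_pow_apply_self]

/-- The number of points of period `d` is `d` times the number of cycles of length `d`. -/
theorem card_minimalPeriod_eq [Fintype α] [DecidableEq α] (σ : Equiv.Perm α) (d : ℕ) :
    (Finset.univ.filter fun i => minimalPeriod σ i = d).card = d * σ.partition.parts.count d := by
  rcases Nat.lt_or_ge d 2 with h | h
  · obtain rfl | rfl : d = 0 ∨ d = 1 := by omega
    · rw [zero_mul, Finset.card_eq_zero, Finset.filter_eq_empty_iff]
      exact fun i _ => (minimalPeriod_perm_pos σ i).ne'
    · have h1 : σ.cycleType.count 1 = 0 :=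
        Multiset.count_eq_zero.2 fun h => absurd (Equiv.Perm.one_lt_of_mem_cycleType h) (by simp)
      rw [Equiv.Perm.parts_partition, Multiset.count_add, h1, Multiset.count_replicate_self,
        one_mul, zero_add, ← Finset.card_compl]
      congr 1
      ext i
      simp [minimalPeriod_eq_one_iff_isFixedPt, IsFixedPt]
  · have h1 : (Multiset.replicate (Fintype.card α - σ.support.card) 1).count d = 0 :=
      Multiset.count_eq_zero.2 fun h' => by have := Multiset.eq_of_mem_replicate h'; omega
    have hne : ∀ i, minimalPeriod σ i = d → σ i ≠ i := fun i hi h' => by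
      have : minimalPeriod σ i = 1 := minimalPeriod_eq_one_iff_isFixedPt.2 h'
      omega
    rw [Equiv.Perm.parts_partition, Multiset.count_add, h1, add_zero,
      Equiv.Perm.cycleType_def, Multiset.count_map, ← Finset.filter_val, Finset.card_val,
      Finset.card_eq_sum_card_fiberwise (f := fun i => σ.cycleOf i)
        (t := σ.cycleFactorsFinset.filter fun c => d = (Finset.card ∘ Equiv.Perm.support) c),
      Finset.sum_const_nat (m := d), mul_comm]
    · intro c hc
      rw [Finset.mem_filter, Function.comp_apply] at hc
      conv_rhs => rw [hc.2]
      congr 1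
      ext i
      rw [Finset.mem_filter, Finset.mem_filter]
      constructor
      · rintro ⟨⟨-, hi⟩, rfl⟩
        simpa using hne i hi
      · intro hi
        have hci := Equiv.Perm.cycle_is_cycleOf hi hc.1
        have hi' : σ i ≠ i := by
          rw [hci] at hi; simpa using hi
        refine ⟨⟨Finset.mem_univ _, ?_⟩, hci.symm⟩
        rw [minimalPeriod_eq_card_support_cycleOf σ hi', ← hci, hc.2]
    · intro i hi
      have hi := (Finset.mem_filter.1 hi).2
      rw [Finset.mem_coe, Finset.mem_filter]
      exact ⟨Equiv.Perm.cycleOf_mem_cycleFactorsFinset_iff.2 (by simpa using hne i hi),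
        by rw [Function.comp_apply, ← minimalPeriod_eq_card_support_cycleOf σ (hne i hi), hi]⟩

theorem zero_notMem_parts [Fintype α] [DecidableEq α] (σ : Equiv.Perm α) : 0 ∉ σ.partition.parts :=
  fun h => absurd (σ.partition.parts_pos h) (lt_irrefl 0)

/-- The cycle type is determined by the numbers of points of given periods. -/
theorem parts_eq_of_card [Fintype α] [DecidableEq α] {σ : Equiv.Perm α} {c : Multiset ℕ} (hc : 0 ∉ c)
    (h : ∀ d, (Finset.univ.filter fun i => minimalPeriod σ i = d).card = d * c.count d) :
    σ.partition.parts = c := by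
  ext d
  rcases Nat.eq_zero_or_pos d with rfl | hd
  · rw [Multiset.count_eq_zero.2 hc, Multiset.count_eq_zero.2 (zero_notMem_parts σ)]
  · exact Nat.eq_of_mul_eq_mul_left hd ((card_minimalPeriod_eq σ d).symm.trans (h d))

theorem minimalPeriod_permCongr (e : α ≃ β) (σ : Equiv.Perm α) (i : α) :
    minimalPeriod (e.permCongr σ) (e i) = minimalPeriod σ i := by
  refine minimalPeriod_eq_minimalPeriod_iff.2 fun k => ?_
  rw [IsPeriodicPt, IsFixedPt, IsPeriodicPt, IsFixedPt, Equiv.Perm.iterate_eq_pow,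
    Equiv.Perm.iterate_eq_pow, ← Equiv.permCongrHom_coe, ← map_pow, Equiv.permCongrHom_coe]
  simp

theorem parts_permCongr [Fintype α] [DecidableEq α] [Fintype β] [DecidableEq β]
    (e : α ≃ β) (σ : Equiv.Perm α) :
    (e.permCongr σ).partition.parts = σ.partition.parts := by
  refine parts_eq_of_card (zero_notMem_parts σ) fun d => ?_
  rw [← card_minimalPeriod_eq]
  refine (Finset.card_equiv e fun i => ?_).symm
  simp [minimalPeriod_permCongr]

theorem card_filter_sum [Fintype α] [Fintype β] (P : α ⊕ β → Prop) [DecidablePred P] :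
    (Finset.univ.filter P).card = (Finset.univ.filter fun i => P (.inl i)).card +
      (Finset.univ.filter fun i => P (.inr i)).card := by
  simp only [Finset.card_filter, Fintype.sum_sum_type]

theorem parts_sumCongr [Fintype α] [DecidableEq α] [Fintype β] [DecidableEq β]
    (σ : Equiv.Perm α) (τ : Equiv.Perm β) :
    (Equiv.Perm.partition (Equiv.sumCongr σ τ)).parts = σ.partition.parts + τ.partition.parts := by
  refine parts_eq_of_card (by simp [zero_notMem_parts]) fun d => ?_
  rw [card_filter_sum, Multiset.count_add, mul_add, ← card_minimalPeriod_eq, ← card_minimalPeriod_eq]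
  have h1 : ∀ k, ∀ i, (Equiv.sumCongr σ τ)^[k] (.inl i) = .inl (σ^[k] i) := by
    intro k i
    induction k with
    | zero => rfl
    | succ k ih => rw [iterate_succ_apply', iterate_succ_apply', ih]; rfl
  have h2 : ∀ k, ∀ i, (Equiv.sumCongr σ τ)^[k] (.inr i) = .inr (τ^[k] i) := by
    intro k i
    induction k with
    | zero => rfl
    | succ k ih => rw [iterate_succ_apply', iterate_succ_apply', ih]; rfl
  have h1' : ∀ i, minimalPeriod (Equiv.sumCongr σ τ) (.inl i) = minimalPeriod σ i := fun i =>
    minimalPeriod_eq_minimalPeriod_iff.2 fun k => by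
      rw [IsPeriodicPt, IsFixedPt, h1, Sum.inl_injective.eq_iff]; rfl
  have h2' : ∀ i, minimalPeriod (Equiv.sumCongr σ τ) (.inr i) = minimalPeriod τ i := fun i =>
    minimalPeriod_eq_minimalPeriod_iff.2 fun k => by
      rw [IsPeriodicPt, IsFixedPt, h2, Sum.inr_injective.eq_iff]; rfl
  simp only [h1', h2']

/-- If a map exchanges two sets, the periods on the first set are twice those of its square. -/
theorem minimalPeriod_of_exchange {f : β → β} {g : α → α} {u w : α → β} (hu : Injective u)
    (huw : ∀ i j, u i ≠ w j) (h2 : ∀ i, f (f (u i)) = u (g i)) (h1 : ∀ i, ∃ j, f (u i) = w j)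
    (i : α) : minimalPeriod f (u i) = 2 * minimalPeriod g i := by
  have heven : ∀ k i, f^[2 * k] (u i) = u (g^[k] i) := by
    intro k i
    induction k with
    | zero => rfl
    | succ k ih =>
      rw [Nat.mul_succ, iterate_succ_apply', iterate_succ_apply', ih, h2, iterate_succ_apply']
  refine Nat.dvd_right_iff_eq.1 fun k => ?_
  rw [← isPeriodicPt_iff_minimalPeriod_dvd]
  -- Even iterates stay in the image of `u` and follow `g`; odd iterates lie in the image of `w`, so
  -- they never return.
  obtain ⟨k, rfl | rfl⟩ := Nat.even_or_odd' k
  · rw [IsPeriodicPt, IsFixedPt, heven, hu.eq_iff, Nat.mul_dvd_mul_iff_left two_pos,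
      ← isPeriodicPt_iff_minimalPeriod_dvd]
    rfl
  · constructor
    · intro h
      rw [IsPeriodicPt, IsFixedPt, iterate_succ_apply', heven] at h
      obtain ⟨j, hj⟩ := h1 (g^[k] i)
      exact absurd (h.symm.trans hj) (huw _ _)
    · intro h
      have := (Dvd.intro _ rfl).trans h
      omega

theorem parts_sumCongr_mul_sumComm [Fintype α] [DecidableEq α] (σ τ : Equiv.Perm α) :
    (Equiv.Perm.partition (Equiv.sumCongr σ τ * Equiv.sumComm α α)).parts =
      (σ * τ).partition.parts.map (2 * ·) := by
  refine parts_eq_of_card (by simp [zero_notMem_parts]) fun d => ?_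
  rw [card_filter_sum]
  have h1 : ∀ i, minimalPeriod (Equiv.sumCongr σ τ * Equiv.sumComm α α) (.inl i) =
      2 * minimalPeriod (σ * τ) i :=
    minimalPeriod_of_exchange (w := Sum.inr) Sum.inl_injective (by simp) (fun i => rfl)
      (fun i => ⟨_, rfl⟩)
  have h2 : ∀ i, minimalPeriod (Equiv.sumCongr σ τ * Equiv.sumComm α α) (.inr i) =
      2 * minimalPeriod (τ * σ) i :=
    minimalPeriod_of_exchange (w := Sum.inl) Sum.inr_injective (by simp) (fun i => rfl)
      (fun i => ⟨_, rfl⟩)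
  simp only [h1, h2]
  have hinj : Injective (fun k : ℕ => 2 * k) := fun a b h => by simpa using h
  rcases Nat.even_or_odd' d with ⟨d, rfl | rfl⟩
  · have hc : (τ * σ).partition = (σ * τ).partition :=
      Equiv.Perm.partition_eq_of_isConj.1 (isConj_iff.2 ⟨σ, by group⟩)
    rw [Multiset.count_map_eq_count' (2 * ·) _ hinj]
    simp only [Nat.mul_right_inj two_ne_zero]
    rw [card_minimalPeriod_eq, card_minimalPeriod_eq, hc]
    ring
  · rw [Multiset.count_eq_zero.2, mul_zero, Finset.filter_false_of_mem, Finset.filter_false_of_mem]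
    · rfl
    · intro i _; omega
    · intro i _; omega
    · rw [Multiset.mem_map]
      rintro ⟨k, -, hk⟩
      omega

end Cycles

/-! ### The Markov process as an algebra homomorphism -/

/-- The cycle data in which equal multisets of degrees have been merged. -/
abbrev CycleData : Type := AddMonoidAlgebra ℚ (Multiset ℕ)

/-- `step` as a homomorphism of algebras. -/
noncomputable def stepHom : Data →ₐ[ℚ] Data :=
  AddMonoidAlgebra.lift ℚ Data FactType
    { toFun := fun F => (F.toAdd.map children).prod
      map_one' := by simp
      map_mul' := fun F G => by simp }

theorem stepHom_apply (D : Data) : stepHom D = step D := AddMonoidAlgebra.lift_apply _ _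

theorem stepHom_datum (F : FactType) (r : ℚ) :
    stepHom (datum F r) = r • (F.map children).prod := AddMonoidAlgebra.lift_single _ _ _

/-- The cycle data after `n` steps of the Markov process. -/
noncomputable def cycleDataHom : ℕ → Data →ₐ[ℚ] CycleData
  | 0 => AddMonoidAlgebra.mapDomainAlgHom ℚ ℚ (Multiset.mapAddMonoidHom Prod.snd)
  -- The first transition is split off rather than the last, to match the tower, which is extended
  -- at the root.
  | n + 1 => (cycleDataHom n).comp stepHom

theorem cycleDataHom_coeff (n : ℕ) (D : Data) :
    (cycleDataHom n D).coeff = (step^[n] D).coeff.mapDomain (Multiset.map Prod.snd) := by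
  induction n generalizing D with
  | zero => rfl
  | succ n ih =>
    rw [Function.iterate_succ_apply, ← ih, ← stepHom_apply]; rfl

theorem modelCycleData_succ (D : Data) (n : ℕ) :
    modelCycleData D (n + 1) = (cycleDataHom n D).coeff :=
  (cycleDataHom_coeff n D).symm

theorem cycleDataHom_zero_datum (T : Typ) (d : ℕ) :
    cycleDataHom 0 (datum {(T, d)} 1) = AddMonoidAlgebra.single {d} 1 := by
  simp [cycleDataHom, datum, AddMonoidAlgebra.mapDomainAlgHom]

theorem cycleDataHom_succ_datum (n : ℕ) (T : Typ) (d : ℕ) :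
    cycleDataHom (n + 1) (datum {(T, d)} 1) = cycleDataHom n (children (T, d)) := by
  rw [cycleDataHom, AlgHom.comp_apply, stepHom_datum]; simp

theorem datum_pair (p q : Typ × ℕ) (r : ℚ) :
    datum {p, q} r = r • (datum {p} 1 * datum {q} 1) := by
  rw [datum, datum, datum, AddMonoidAlgebra.single_mul_single, AddMonoidAlgebra.smul_single]
  simp

theorem children_of_n {T : Typ} (hT : T.1 = .n) (d : ℕ) :
    children (T, d) = datum {(T.shift, 2 * d)} 1 := by
  simp only [children, hT]

theorem card_allowable {T : Typ} (hT : T.1 = .s) : (allowable T).card = 4 := by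
  revert T; decide

/-- When T starts with s, the product f(T) ends with s, so the agreement of the last digits is
automatic. -/
theorem mem_allowable {T : Typ} (hT : T.1 = .s) (q : Typ × Typ) :
    q ∈ allowable T ↔ (q.1 * q.2).shift = T := by
  revert T q; decide

theorem children_of_s {T : Typ} (hT : T.1 = .s) (d : ℕ) :
    children (T, d) = ∑ q ∈ allowable T,
      (1 / 4 : ℚ) • (datum {(q.1, d)} 1 * datum {(q.2, d)} 1) := by
  simp only [children, hT, card_allowable hT, datum_pair]
  norm_num

/-! ### The cycle data of the tower -/

/-- The sum of the cycle types, with all lengths multiplied by `d`, of the elements of type `T`. -/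
noncomputable def cycleSum (n : ℕ) (T : Typ) (d : ℕ) : CycleData :=
  ∑ w : Tow n, if (tower n).typ w = T then
    AddMonoidAlgebra.single ((act n w).partition.parts.map (d * ·)) 1 else 0

theorem parts_act_of_swap {n : ℕ} {w : Ext (tower n).typ} (hw : w.swap = .n) :
    (act (n + 1) w).partition.parts = (act n (w.fst * w.snd)).partition.parts.map (2 * ·) := by
  rw [act_succ, parts_permCongr, Ext.act_of_swap _ hw, parts_sumCongr_mul_sumComm, map_mul]

theorem parts_act_of_not_swap {n : ℕ} {w : Ext (tower n).typ} (hw : w.swap = .s) :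
    (act (n + 1) w).partition.parts =
      (act n w.fst).partition.parts + (act n w.snd).partition.parts := by
  rw [act_succ, parts_permCongr, Ext.act_of_not_swap _ hw, parts_sumCongr]

theorem sum_tow_succ {R : Type} [AddCommMonoid R] (n : ℕ) (F : Tow (n + 1) → R) :
    ∑ w, F w = ∑ g : Tow n, ∑ h : Tow n, F (⟨g, h⟩ : Ext (tower n).typ) := by
  rw [← Fintype.sum_prod_type']
  exact Fintype.sum_equiv (Ext.equivProd (tower n).typ) _ _ fun w => rfl

/-- The cycles depend only on the product gh, and every product arises from as many pairs as the
group has elements. -/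
theorem cycleSum_succ_of_n (n : ℕ) {T : Typ} (hT : T.1 = .n) (d : ℕ) :
    cycleSum (n + 1) T d = (Fintype.card (Tow n) : ℚ) • cycleSum n T.shift (2 * d) := by
  have h1 : ∀ g h : Tow n, (if (tower (n + 1)).typ (⟨g, h⟩ : Ext (tower n).typ) = T then
      AddMonoidAlgebra.single ((act (n + 1) (⟨g, h⟩ : Ext (tower n).typ)).partition.parts.map (d * ·))
        1 else 0 : CycleData) = if (tower n).typ (g * h) = T.shift then
      AddMonoidAlgebra.single ((act n (g * h)).partition.parts.map (2 * d * ·)) 1 else 0 := by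
    intro g h
    have h2 : (tower (n + 1)).typ (⟨g, h⟩ : Ext (tower n).typ) = ((tower n).typ (g * h)).shift := by
      rw [map_mul]; rfl
    by_cases h3 : (tower n).typ (g * h) = T.shift
    · have h4 : (tower (n + 1)).typ (⟨g, h⟩ : Ext (tower n).typ) = T := by rw [h2, h3]; rfl
      rw [if_pos h3, if_pos h4, parts_act_of_swap (w := ⟨g, h⟩), Multiset.map_map]
      · simp only [Function.comp_def, mul_left_comm d, mul_assoc]
      · rw [Ext.swap, ← map_mul, h3]; exact hT
    · rw [if_neg h3, if_neg]
      rw [h2]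
      rintro rfl
      exact h3 rfl
  rw [cycleSum, sum_tow_succ, Finset.sum_comm]
  simp only [h1]
  have h5 : ∀ h : Tow n, (∑ g : Tow n, if (tower n).typ (g * h) = T.shift then
      AddMonoidAlgebra.single ((act n (g * h)).partition.parts.map (2 * d * ·)) 1 else 0) =
      cycleSum n T.shift (2 * d) := fun h =>
    Fintype.sum_equiv (Equiv.mulRight h) _ _ fun g => rfl
  simp only [h5, Finset.sum_const, Finset.card_univ, Nat.cast_smul_eq_nsmul]

/-- The sections are independent once their types are fixed, and the union of their cycle types is
the product of monomials in the monoid algebra. -/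
theorem cycleSum_succ_of_s (n : ℕ) {T : Typ} (hT : T.1 = .s) (d : ℕ) :
    cycleSum (n + 1) T d = ∑ q ∈ allowable T, cycleSum n q.1 d * cycleSum n q.2 d := by
  have h1 : ∀ g h : Tow n, (if (tower (n + 1)).typ (⟨g, h⟩ : Ext (tower n).typ) = T then
      AddMonoidAlgebra.single ((act (n + 1) (⟨g, h⟩ : Ext (tower n).typ)).partition.parts.map (d * ·))
        1 else 0 : CycleData) = ∑ q ∈ allowable T,
      (if (tower n).typ g = q.1 then
        AddMonoidAlgebra.single ((act n g).partition.parts.map (d * ·)) 1 else 0) *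
      (if (tower n).typ h = q.2 then
        AddMonoidAlgebra.single ((act n h).partition.parts.map (d * ·)) 1 else 0) := by
    intro g h
    have h2 : (tower (n + 1)).typ (⟨g, h⟩ : Ext (tower n).typ) =
        ((tower n).typ g * (tower n).typ h).shift := rfl
    have h3 : ∀ q : Typ × Typ, q ≠ ((tower n).typ g, (tower n).typ h) →
      ((if (tower n).typ g = q.1 then
        AddMonoidAlgebra.single ((act n g).partition.parts.map (d * ·)) 1 else 0) *
      (if (tower n).typ h = q.2 then
        AddMonoidAlgebra.single ((act n h).partition.parts.map (d * ·)) 1 else 0) : CycleData) = 0 := by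
      intro q hq
      split_ifs with e e'
      · exact absurd (Prod.ext e.symm e'.symm) hq
      all_goals simp
    by_cases h4 : (tower (n + 1)).typ (⟨g, h⟩ : Ext (tower n).typ) = T
    · rw [if_pos h4, Finset.sum_eq_single_of_mem ((tower n).typ g, (tower n).typ h)
        ((mem_allowable hT _).2 h4) (fun q _ hq => h3 q hq), if_pos rfl, if_pos rfl,
        AddMonoidAlgebra.single_mul_single, parts_act_of_not_swap (w := ⟨g, h⟩), Multiset.map_add,
        one_mul]
      have : Ext.swap (⟨g, h⟩ : Ext (tower n).typ) = T.1 := by rw [← h4]; rfl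
      rw [this, hT]
    · rw [if_neg h4, Finset.sum_eq_zero]
      intro q hq
      refine h3 q ?_
      rintro rfl
      exact h4 ((mem_allowable hT _).1 hq)
  rw [cycleSum, sum_tow_succ]
  simp only [h1]
  simp only [cycleSum, Finset.sum_mul_sum]
  rw [Finset.sum_comm (s := allowable T)]
  exact Finset.sum_congr rfl fun g _ => Finset.sum_comm

theorem card_tow_succ (n : ℕ) :
    (Fintype.card (Tow (n + 1)) : ℚ) = (Fintype.card (Tow n) : ℚ) ^ 2 := by
  rw [card_tow, card_tow, pow_succ 2, pow_mul]; push_cast; rfl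

/-- The elements of a given type in the tower have the cycle data of the Markov process that starts
with a single factor of this type. -/
theorem cycleSum_eq (n : ℕ) (T : Typ) (d : ℕ) :
    cycleSum n T d = (Fintype.card (Tow n) / 4 : ℚ) • cycleDataHom n (datum {(T, d)} 1) := by
  induction n generalizing T d with
  | zero =>
    have h1 : ∀ w : Tow 0, (act 0 w).partition.parts = {1} := by
      intro w
      rw [show act 0 w = 1 from rfl, Equiv.Perm.parts_partition]; simp
    have h2 : (Fintype.card (Tow 0) / 4 : ℚ) = 1 := by rw [card_tow]; norm_num
    rw [cycleSum, h2, one_smul, cycleDataHom_zero_datum]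
    simp only [h1, Multiset.map_singleton, mul_one]
    refine (Fintype.sum_eq_single T fun w hw => if_neg hw).trans (if_pos rfl)
  | succ n ih =>
    rw [cycleDataHom_succ_datum, card_tow_succ]
    rcases hT : T.1
    · rw [cycleSum_succ_of_n n hT, ih, smul_smul, children_of_n hT]
      congr 1; ring
    · rw [cycleSum_succ_of_s n hT, children_of_s hT, map_sum, Finset.smul_sum]
      refine Finset.sum_congr rfl fun q _ => ?_
      rw [ih, ih, map_smul, map_mul, smul_smul, smul_mul_smul_comm]
      congr 1; ring

/-- Model 5 arises from four equally probable factors of degree `1`. -/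
theorem stepHom_level_zero :
    stepHom (∑ T : Typ, (1 / 4 : ℚ) • datum {(T, 1)} 1) = model5 := by
  have h1 : (Finset.univ : Finset Typ) = {nn, ns, sn, ss} := by decide
  have h2 : allowable sn = {(ns, ss), (ss, ns), (nn, sn), (sn, nn)} := by decide
  have h3 : allowable ss = {(nn, nn), (ns, ns), (sn, sn), (ss, ss)} := by decide
  have h4 : ∀ T : Typ, stepHom ((1 / 4 : ℚ) • datum {(T, 1)} 1) = (1 / 4 : ℚ) • children (T, 1) := by
    intro T
    rw [map_smul, stepHom_datum]; simp
  have h5 : ∀ (F : FactType) (r t : ℚ), r • datum F t = datum F (r * t) := fun F r t =>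
    AddMonoidAlgebra.smul_single' _ _ _
  -- Ordered pairs of distinct types occur in both orders, each of density 1/16; this gives the
  -- coefficients 1/8 of Model 5.
  have h6 : ∀ F : FactType, datum F (1 / 8) = datum F (1 / 16) + datum F (1 / 16) := fun F => by
    rw [datum, datum, ← AddMonoidAlgebra.single_add]; norm_num
  have hnn : children (nn, 1) = datum {(nn, 2)} 1 := children_of_n rfl 1
  have hns : children (ns, 1) = datum {(sn, 2)} 1 := children_of_n rfl 1
  have hsn : children (sn, 1) = datum {(ns, 1), (ss, 1)} (1 / 4) + (datum {(ns, 1), (ss, 1)} (1 / 4)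
      + (datum {(nn, 1), (sn, 1)} (1 / 4) + datum {(nn, 1), (sn, 1)} (1 / 4))) := by
    rw [children_of_s rfl, h2, Finset.sum_insert (by decide), Finset.sum_insert (by decide),
      Finset.sum_insert (by decide), Finset.sum_singleton, Multiset.pair_comm (ns, 1)]
    simp only [← datum_pair]
    rw [Multiset.pair_comm (ns, 1), Multiset.pair_comm (sn, 1), Multiset.pair_comm (ss, 1)]
  have hss : children (ss, 1) = datum {(nn, 1), (nn, 1)} (1 / 4) + (datum {(ns, 1), (ns, 1)} (1 / 4)
      + (datum {(sn, 1), (sn, 1)} (1 / 4) + datum {(ss, 1), (ss, 1)} (1 / 4))) := by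
    rw [children_of_s rfl, h3, Finset.sum_insert (by decide), Finset.sum_insert (by decide),
      Finset.sum_insert (by decide), Finset.sum_singleton]
    simp only [← datum_pair]
  rw [map_sum, h1, Finset.sum_insert (by decide), Finset.sum_insert (by decide),
    Finset.sum_insert (by decide), Finset.sum_singleton, h4, h4, h4, h4, hnn, hns, hsn, hss, model5]
  simp only [smul_add, h5, h6]
  norm_num
  abel

theorem sum_single_parts (n : ℕ) :
    (∑ w : Tow (n + 1), AddMonoidAlgebra.single ((act (n + 1) w).partition.parts) 1 : CycleData) =
      (Fintype.card (Tow (n + 1)) : ℚ) • cycleDataHom n model5 := by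
  have h1 : (∑ w : Tow (n + 1), AddMonoidAlgebra.single ((act (n + 1) w).partition.parts) 1 :
      CycleData) = ∑ T : Typ, cycleSum (n + 1) T 1 := by
    simp only [cycleSum]
    rw [Finset.sum_comm]
    simp
  rw [h1, ← stepHom_level_zero]
  simp only [cycleSum_eq]
  rw [← AlgHom.comp_apply, ← cycleDataHom, map_sum, Finset.smul_sum]
  refine Finset.sum_congr rfl fun T _ => ?_
  rw [map_smul, smul_smul]
  congr 1; ring

theorem card_parts_eq (n : ℕ) (c : Multiset ℕ) :
    (Nat.card {w : Tow (n + 1) // (act (n + 1) w).partition.parts = c} : ℚ) =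
      Fintype.card (Tow (n + 1)) * modelCycleData model5 (n + 1) c := by
  have h := congrArg (fun D : CycleData => D.coeff c) (sum_single_parts n)
  rw [modelCycleData_succ]
  refine Eq.trans ?_ h
  classical
  rw [Nat.card_eq_fintype_card, Fintype.card_subtype, Finset.card_filter]
  simp [Finsupp.single_apply, AddMonoidAlgebra.coeff_sum, Finsupp.finsetSum_apply]

/-- A homomorphism of finite groups preserves proportions. -/
theorem card_subtype_mul_card_range {G H : Type} [Group G] [Group H] [Finite G] (f : G →* H)
    (P : H → Prop) : Nat.card {g : G // P (f g)} * Nat.card f.range =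
      Nat.card {y : f.range // P y} * Nat.card G := by
  have hs : ∀ y : f.range, ∃ g, f g = y := fun y => y.2
  choose s hs using hs
  have hr : ∀ g, f (s (f.rangeRestrict g)) = f g := fun g => hs _
  have key : ∀ P : H → Prop, Nat.card {g : G // P (f g)} =
      Nat.card {y : f.range // P y} * Nat.card f.ker := by
    intro P
    rw [← Nat.card_prod]
    refine Nat.card_congr
      { toFun := fun g => (⟨f.rangeRestrict g.1, g.2⟩,
          ⟨(s (f.rangeRestrict g.1))⁻¹ * g.1, by rw [f.mem_ker, map_mul, map_inv, hr]; simp⟩)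
        invFun := fun p => ⟨s p.1.1 * p.2.1, by
          rw [map_mul, hs, f.mem_ker.1 p.2.2, mul_one]; exact p.1.2⟩
        left_inv := fun g => by simp
        right_inv := fun p => ?_ }
    have h : f.rangeRestrict (s p.1.1 * p.2.1) = p.1.1 := by
      apply Subtype.ext
      rw [MonoidHom.coe_rangeRestrict, map_mul, hs, f.mem_ker.1 p.2.2, mul_one]
    ext1
    · exact Subtype.ext h
    · apply Subtype.ext
      simp only [h]
      simp
  have h1 := key P
  have h2 : Nat.card G = Nat.card f.range * Nat.card f.ker := by
    simpa [Nat.card_congr (Equiv.subtypeUnivEquiv _)] using key fun _ => True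
  rw [h1, h2]; ring

end PCFMarkov

/-! ### Passage from the tower to its image -/

theorem theoremC (n : ℕ) (hn : 1 ≤ n) :
    PCFMarkov.Satisfies PCFMarkov.model5 n (PCFMarkov.M n) := by
  obtain ⟨n, rfl⟩ := Nat.exists_eq_add_of_le' hn
  rw [← PCFMarkov.range_act hn]
  refine ⟨?_, fun c => ?_⟩
  · rintro _ ⟨w, rfl⟩
    exact PCFMarkov.act_mem_treeAut _ w
  · have h1 := PCFMarkov.card_parts_eq n c
    have h2 := PCFMarkov.card_subtype_mul_card_range (PCFMarkov.act (n + 1))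
      fun g => g.partition.parts = c
    have h3 : (Nat.card (PCFMarkov.act (n + 1)).range : ℚ) ≠ 0 := by
      exact_mod_cast Nat.card_pos.ne'
    have h4 : (Nat.card (PCFMarkov.Tow (n + 1)) : ℚ) ≠ 0 := by
      exact_mod_cast Nat.card_pos.ne'
    rw [← Nat.card_eq_fintype_card (α := PCFMarkov.Tow (n + 1))] at h1
    rw [PCFMarkov.cycleProportion, div_eq_iff h3]
    apply mul_right_cancel₀ h4
    calc _ = ((Nat.card {g : PCFMarkov.Tow (n + 1) //
              (PCFMarkov.act (n + 1) g).partition.parts = c} : ℚ) *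
            Nat.card (PCFMarkov.act (n + 1)).range) := by exact_mod_cast h2.symm
      _ = _ := by rw [h1]; ring
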